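/- A *triangle-pentagon complex* $X$ is a two-dimensional cell complex whose $1$-skeleton is a (simple) graph $G$ and whose $2$-cells are solid triangles and solid pentagons, the boundary of each being identified by an isomorphism with a $3$-cycle, respectively a $5$-cycle, of $G$; the pentagons have no diagonals in $G$, and $G$ has no full (i.e. induced) $4$-cycle. Let each edge have length $1$, let each triangle be a Euclidean equilateral triangle of side $1$ and each pentagon a regular Euclidean pentagon of side $1$, and let $d$ be the resulting intrinsic metric on $X$. Call $X$ *CAT(0)* if $(X,d)$ is a CAT(0) space. Let $X^{\star}$ be the simplicial complex obtained from $X$ by adding the center of each pentagon as a new vertex and dividing each pentagon into five triangles by joining its center to its five vertices. (The metric $d^{\star}$ on $X^{\star}$, for which the triangles of $X$ are equilateral and each subdivided pentagon is a flat regular pentagon, is then the metric $d$.) A cycle (a subcomplex that is a triangulation of the circle) of a simplicial complex is *full* if every simplex of the complex whose vertices all lie on the cycle belongs to the cycle. The *link* of a simplex $\sigma$ consists of all simplices disjoint from $\sigma$ that together with $\sigma$ span a simplex. A complex is *flag* if every nonempty finite set of pairwise adjacent vertices spans a simplex; it is *locally $5$-large* if the link of every simplex is flag and contains no full cycle of length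 less than $5$. For $k\ge 3$, a vertex is called (exactly) *$k$-large* here if the shortest full cycles in its link have length $k$. **Lemma 3.2.** Let $X$ be a CAT(0) triangle-pentagon complex. Then $X^{\star}$ has no $3$-large and no $4$-large vertices. Moreover, $X^{\star}$ is flag and locally $5$-large, and every $5$-large vertex of $X^{\star}$ is the center of a pentagon of $X$. -/

import Mathlib

/-! ### Simplicial complexes: flagness, full cycles, links, largeness -/

open Classical in
/-- A simplicial complex is flag if every nonempty finite set of vertices which are pairwise joined
by edges spans a simplex (for `v = w` the condition says that `v` is a vertex). -/
def IsFlagComplex {α : Type*} (K : PreAbstractSimplicialComplex α) : Prop :=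
  ∀ s : Finset α, s.Nonempty → (∀ v ∈ s, ∀ w ∈ s, ({v, w} : Finset α) ∈ K.faces) → s ∈ K.faces

open Classical in
/-- `K` has a full cycle of length `k`: a subcomplex that is a triangulation of the circle with `k`
vertices and `k` edges (so `k ≥ 3`), such that each simplex of `K` all of whose vertices lie on the
cycle is a vertex or an edge of the cycle. -/
def HasFullCycle {α : Type*} (K : PreAbstractSimplicialComplex α) (k : ℕ) : Prop :=
  3 ≤ k ∧ ∃ c : Fin k → α, Function.Injective c ∧
    (∀ i j, (SimpleGraph.cycleGraph k).Adj i j → ({c i, c j} : Finset α) ∈ K.faces) ∧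
    ∀ s ∈ K.faces, (s : Set α) ⊆ Set.range c →
      ∃ i j, (SimpleGraph.cycleGraph k).Adj i j ∧ s ⊆ {c i, c j}

open Classical in
/-- The link of `σ` in `K`: the simplices of `K` that are disjoint from `σ` and that together
with `σ` span a simplex of `K`. -/
def simplicialLink {α : Type*} (K : PreAbstractSimplicialComplex α) (σ : Finset α) :
    PreAbstractSimplicialComplex α where
  faces := {τ | τ ∈ K.faces ∧ Disjoint τ σ ∧ τ ∪ σ ∈ K.faces}
  isRelLowerSet_faces := by
    rintro τ ⟨h1, h2, h3⟩
    refine ⟨(K.isRelLowerSet_faces h1).1, fun ρ hρ hne => ⟨?_, ?_, ?_⟩⟩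
    · exact (K.isRelLowerSet_faces h1).2 hρ hne
    · exact Finset.disjoint_of_subset_left hρ h2
    · exact (K.isRelLowerSet_faces h3).2 (Finset.union_subset_union_left hρ)
        (hne.mono Finset.subset_union_left)

/-- `K` is `k`-large: it is flag and has no full `j`-cycles for `j < k`. -/
def IsLargeComplex {α : Type*} (k : ℕ) (K : PreAbstractSimplicialComplex α) : Prop :=
  IsFlagComplex K ∧ ∀ j < k, ¬ HasFullCycle K j

/-- `K` is locally `k`-large: the links of all its simplices are `k`-large. -/
def IsLocallyLargeComplex {α : Type*} (k : ℕ) (K : PreAbstractSimplicialComplex α) : Prop :=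
  ∀ σ ∈ K.faces, IsLargeComplex k (simplicialLink K σ)

/-- The vertex `v` is `k`-large in the sharp sense (`k`-large but not `(k+1)`-large): the link of
`v` has a full cycle of length `k` and no shorter full cycle. Flagness of the link is not required,
because a full `3`-cycle already violates it. -/
def IsExactlyLargeVertex {α : Type*} (K : PreAbstractSimplicialComplex α) (k : ℕ) (v : α) : Prop :=
  HasFullCycle (simplicialLink K {v}) k ∧ ∀ j < k, ¬ HasFullCycle (simplicialLink K {v}) j

/-! ### CAT(0) spaces -/

/-- `γ`, restricted to `[0, L]`, is a geodesic from `x` to `y` of length `L`. -/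
def IsGeodesicPath {M : Type*} [PseudoEMetricSpace M] (γ : ℝ → M) (L : ℝ) (x y : M) : Prop :=
  0 ≤ L ∧ γ 0 = x ∧ γ L = y ∧
    ∀ s ∈ Set.Icc 0 L, ∀ t ∈ Set.Icc 0 L, edist (γ s) (γ t) = ENNReal.ofReal |s - t|

/-- `M` is a CAT(0) space: it is a geodesic space, and for every geodesic triangle (vertices
`p, q, r`, sides `α, β, γ`) and every comparison triangle (vertices `p', q', r'`) in the Euclidean
plane, two points of the triangle are at most as far apart as their comparison points. It is enough
to name points on the two sides issuing from `p`, as the vertices may be permuted (and for two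
points of one side there is nothing to say). That any two points are joined by a geodesic forces
distances to be finite, and points at distance `0` to be equal, so `M` is a metric space. -/
def IsCATZero (M : Type*) [PseudoEMetricSpace M] : Prop :=
  (∀ x y : M, ∃ (L : ℝ) (γ : ℝ → M), IsGeodesicPath γ L x y) ∧
  ∀ (p q r : M) (a b c : ℝ) (α β γ : ℝ → M),
    IsGeodesicPath α a p q → IsGeodesicPath β b p r → IsGeodesicPath γ c q r →
    ∀ p' q' r' : EuclideanSpace ℝ (Fin 2), dist p' q' = a → dist p' r' = b → dist q' r' = c →
    ∀ s ∈ Set.Icc 0 a, ∀ t ∈ Set.Icc 0 b,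
    ∀ x' ∈ segment ℝ p' q', ∀ y' ∈ segment ℝ p' r', dist p' x' = s → dist p' y' = t →
      edist (α s) (β t) ≤ edist x' y'

/-! ### Regular polygons of side length one -/

/-- The corners, in cyclic order, of the regular `n`-gon with centre `0` and side length `1`. -/
noncomputable def polygonCorner (n : ℕ) (i : Fin n) : ℂ :=
  ((1 / (2 * Real.sin (Real.pi / n)) : ℝ) : ℂ) *
    Complex.exp (((2 * Real.pi * (i : ℕ) / n : ℝ) : ℂ) * Complex.I)

/-- The solid regular `n`-gon with centre `0` and side length `1`. -/
def solidPolygon (n : ℕ) : Set ℂ :=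
  convexHull ℝ (Set.range (polygonCorner n))

/-! ### Triangle-pentagon complexes -/

/-- A triangle-pentagon complex with vertex set `V`: a graph `graph` (the `1`-skeleton), together
with triangles (indexed by `T`) and pentagons (indexed by `P`), whose boundaries are identified by
isomorphisms with `3`-cycles and `5`-cycles of the graph. Graph embeddings `↪g` have induced
images; so the pentagons have no diagonals. There are no full `4`-cycles. -/
structure TrianglePentagonComplex (V T P : Type*) where
  graph : SimpleGraph V
  tri : T → (SimpleGraph.cycleGraph 3 ↪g graph)
  pent : P → (SimpleGraph.cycleGraph 5 ↪g graph)
  no_full_four_cycle : IsEmpty (SimpleGraph.cycleGraph 4 ↪g graph)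

namespace TrianglePentagonComplex

/-- The points of the disjoint union of all closed cells of `X`: the vertices, a unit interval for
each oriented edge, a solid regular triangle for each triangle and a solid regular pentagon for
each pentagon, all with side length `1`. -/
inductive CellPoint {V T P : Type*} (X : TrianglePentagonComplex V T P)
  | vertex (v : V)
  | edge (e : X.graph.Dart) (s : unitInterval)
  | tri (t : T) (z : solidPolygon 3)
  | pent (p : P) (z : solidPolygon 5)

/-- The gluing of the cells: the start of an oriented edge is glued to the initial vertex of the
edge, the two orientations of an edge are glued to each other, and the side of a polygon from its
corner `i` to its corner `i + 1` is glued to the edge which the attaching map assigns to it. -/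
inductive Glue {V T P : Type*} (X : TrianglePentagonComplex V T P) :
    X.CellPoint → X.CellPoint → Prop
  | start (e : X.graph.Dart) : Glue X (.edge e 0) (.vertex e.fst)
  | flip (e : X.graph.Dart) (s : unitInterval) :
      Glue X (.edge e s) (.edge e.symm (unitInterval.symm s))
  | triSide (t : T) (i : Fin 3) (e : X.graph.Dart) (s : unitInterval) (z : solidPolygon 3)
      (hfst : e.fst = X.tri t i) (hsnd : e.snd = X.tri t (i + 1))
      (hz : (z : ℂ) = AffineMap.lineMap (polygonCorner 3 i) (polygonCorner 3 (i + 1)) (s : ℝ)) :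
      Glue X (.tri t z) (.edge e s)
  | pentSide (p : P) (i : Fin 5) (e : X.graph.Dart) (s : unitInterval) (z : solidPolygon 5)
      (hfst : e.fst = X.pent p i) (hsnd : e.snd = X.pent p (i + 1))
      (hz : (z : ℂ) = AffineMap.lineMap (polygonCorner 5 i) (polygonCorner 5 (i + 1)) (s : ℝ)) :
      Glue X (.pent p z) (.edge e s)

/-- The space underlying `X`: its cells, glued along their boundaries. -/
def Realization {V T P : Type*} (X : TrianglePentagonComplex V T P) : Type _ :=
  Quot X.Glue

/-- `X.CellStep x y l`: the points `x` and `y` of the space lie in a common closed cell, at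
Euclidean distance `l` in that cell. -/
inductive CellStep {V T P : Type*} (X : TrianglePentagonComplex V T P) :
    X.Realization → X.Realization → ℝ → Prop
  | edge (e : X.graph.Dart) (s t : unitInterval) :
      CellStep X (Quot.mk _ (.edge e s)) (Quot.mk _ (.edge e t)) (dist s t)
  | tri (t : T) (z w : solidPolygon 3) :
      CellStep X (Quot.mk _ (.tri t z)) (Quot.mk _ (.tri t w)) (dist z w)
  | pent (p : P) (z w : solidPolygon 5) :
      CellStep X (Quot.mk _ (.pent p z)) (Quot.mk _ (.pent p w)) (dist z w)

/-- `X.CellString x y l`: there is a string `x = x₀, x₁, …, xₘ = y` of points such that consecutive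
points lie in a common closed cell, and `l` is the sum of their distances in these cells. -/
inductive CellString {V T P : Type*} (X : TrianglePentagonComplex V T P) :
    X.Realization → X.Realization → ℝ → Prop
  | nil (x : X.Realization) : CellString X x x 0
  | cons {x y z : X.Realization} {a l : ℝ} (h : CellStep X x y a) (h' : CellString X y z l) :
      CellString X x z (a + l)

theorem CellStep.nonneg {V T P : Type*} {X : TrianglePentagonComplex V T P}
    {x y : X.Realization} {a : ℝ} (h : X.CellStep x y a) : 0 ≤ a := by
  cases h <;> exact dist_nonneg

theorem CellStep.symm {V T P : Type*} {X : TrianglePentagonComplex V T P}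
    {x y : X.Realization} {a : ℝ} (h : X.CellStep x y a) : X.CellStep y x a := by
  cases h with
  | edge e s t => rw [dist_comm]; exact .edge e t s
  | tri t z w => rw [dist_comm]; exact .tri t w z
  | pent p z w => rw [dist_comm]; exact .pent p w z

theorem CellString.nonneg {V T P : Type*} {X : TrianglePentagonComplex V T P}
    {x y : X.Realization} {l : ℝ} (h : X.CellString x y l) : 0 ≤ l := by
  induction h with
  | nil => exact le_rfl
  | cons h _ ih => exact add_nonneg h.nonneg ih

theorem CellString.append {V T P : Type*} {X : TrianglePentagonComplex V T P}
    {x y z : X.Realization} {l m : ℝ} (h : X.CellString x y l) (h' : X.CellString y z m) :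
    X.CellString x z (l + m) := by
  induction h with
  | nil => simpa using h'
  | cons h _ ih => rw [add_assoc]; exact .cons h (ih h')

theorem CellString.symm {V T P : Type*} {X : TrianglePentagonComplex V T P}
    {x y : X.Realization} {l : ℝ} (h : X.CellString x y l) : X.CellString y x l := by
  induction h with
  | nil => exact .nil _
  | cons h _ ih =>
    rw [add_comm]
    refine ih.append ?_
    simpa using CellString.cons h.symm (.nil _)

/-- The intrinsic metric of `X`: the infimum of the lengths of strings. -/
noncomputable instance {V T P : Type*} (X : TrianglePentagonComplex V T P) :
    PseudoEMetricSpace X.Realization where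
  edist x y := ⨅ (l : ℝ) (_ : X.CellString x y l), ENNReal.ofReal l
  edist_self x := le_antisymm ((iInf₂_le 0 (.nil x)).trans (by simp)) bot_le
  edist_comm x y := le_antisymm
    (le_iInf₂ fun l h => iInf₂_le l h.symm) (le_iInf₂ fun l h => iInf₂_le l h.symm)
  edist_triangle x y z := by
    rw [ENNReal.iInf_add]
    refine le_iInf fun l => ?_
    rw [ENNReal.iInf_add]
    refine le_iInf fun h => ?_
    rw [ENNReal.add_iInf]
    refine le_iInf fun m => ?_
    rw [ENNReal.add_iInf]
    refine le_iInf fun h' => ?_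
    rw [← ENNReal.ofReal_add h.nonneg h'.nonneg]
    exact iInf₂_le _ (h.append h')

/-- The subdivision `X*`: the simplicial complex whose vertices are the vertices of `X` and the
centres `Sum.inr p` of the pentagons `p` of `X`, and whose simplices are the nonempty subsets of:
single vertices, edges of `X`, triangles of `X`, and the five triangles into which each pentagon is
divided by joining its centre to its vertices. -/
def subdivision {V T P : Type*} (X : TrianglePentagonComplex V T P) :
    AbstractSimplicialComplex (V ⊕ P) where
  faces := {s | s.Nonempty ∧
    ((∃ v : V ⊕ P, (s : Set (V ⊕ P)) ⊆ {v}) ∨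
     (∃ u w : V, X.graph.Adj u w ∧ (s : Set (V ⊕ P)) ⊆ {Sum.inl u, Sum.inl w}) ∨
     (∃ t : T, (s : Set (V ⊕ P)) ⊆ Set.range fun i : Fin 3 => Sum.inl (X.tri t i)) ∨
     (∃ (p : P) (i : Fin 5), (s : Set (V ⊕ P)) ⊆
        {Sum.inr p, Sum.inl (X.pent p i), Sum.inl (X.pent p (i + 1))}))}
  isRelLowerSet_faces := by
    rintro s ⟨hs, h⟩
    refine ⟨hs, fun r hr hne => ⟨hne, ?_⟩⟩
    have hr' : (r : Set (V ⊕ P)) ⊆ s := Finset.coe_subset.mpr hr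
    rcases h with ⟨v, h⟩ | ⟨u, w, hu, h⟩ | ⟨t, h⟩ | ⟨p, i, h⟩
    · exact .inl ⟨v, hr'.trans h⟩
    · exact .inr (.inl ⟨u, w, hu, hr'.trans h⟩)
    · exact .inr (.inr (.inl ⟨t, hr'.trans h⟩))
    · exact .inr (.inr (.inr ⟨p, i, hr'.trans h⟩))
  singleton_mem v := ⟨Finset.singleton_nonempty v, .inl ⟨v, by simp⟩⟩

end TrianglePentagonComplex

/-! ### Metric geometry of the regular triangle and pentagon -/

/-! The combinatorial claims reduce to statements about `starGraph`, the 1-skeleton of the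
subdivision. A clique containing a pentagon centre has its other vertices on that pentagon, hence
among two consecutive corners. For the remaining cliques, flagness needs that every 3-cycle of G
bounds a triangle (`exists_tri_of_adj`) and that G has no four mutually adjacent vertices
(`not_four_clique`). In a flag complex a full cycle of a link is full in the whole complex, so local
5-largeness follows once `starGraph` has no full 4-cycle (`starGraph_no_four_cycle`). Finally, a
5-large vertex of X would be the hub of a 5-wheel whose rim has no chords
(`starGraph_no_five_wheel`).

Each forbidden configuration is refuted metrically: CAT(0) inequalities make some points close,
while the cell structure keeps them apart.

Lower bounds: around each of two points put a cone `max 0 (r - dist)`, of radius small enough to be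
consistent with the gluing. If in every cell containing both apexes these are at least r₁ + r₂
apart, the difference of the cones is 1-Lipschitz along strings, so the points have distance at
least r₁ + r₂ in X (`Marking.ofReal_le_edist`). This requires only distances inside one regular
triangle or pentagon.

Upper bounds: comparison with the Euclidean plane gives the midpoint inequality and two
quadrilateral inequalities. The sum of squared sides suffices for 4-cycles; 5-wheels need the
sharper `IsCATZero.diagonals_sq_le'`, applied to four points of which one opposite pair is at most
√3 apart. -/

theorem dist_sq_polygonCorner (n : ℕ) (i j : Fin n) :
    dist (polygonCorner n i) (polygonCorner n j) ^ 2 =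
      2 * (1 / (2 * Real.sin (Real.pi / n))) ^ 2 *
        (1 - Real.cos (2 * Real.pi * (i : ℕ) / n - 2 * Real.pi * (j : ℕ) / n)) := by
  rw [dist_eq_norm, ← Complex.normSq_eq_norm_sq, polygonCorner, polygonCorner, ← mul_sub,
    Complex.normSq_mul, Complex.normSq_ofReal, Complex.normSq_apply, Real.cos_sub]
  simp only [Complex.sub_re, Complex.sub_im, Complex.exp_ofReal_mul_I_re,
    Complex.exp_ofReal_mul_I_im]
  have h1 := Real.sin_sq_add_cos_sq (2 * Real.pi * (i : ℕ) / n)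
  have h2 := Real.sin_sq_add_cos_sq (2 * Real.pi * (j : ℕ) / n)
  linear_combination (1 / (2 * Real.sin (Real.pi / n))) ^ 2 * (h1 + h2)

theorem norm_sq_polygonCorner (n : ℕ) (i : Fin n) :
    ‖polygonCorner n i‖ ^ 2 = (1 / (2 * Real.sin (Real.pi / n))) ^ 2 := by
  rw [polygonCorner, norm_mul, Complex.norm_exp_ofReal_mul_I, Complex.norm_real, mul_one,
    Real.norm_eq_abs, sq_abs]

theorem radius_sq_three : (1 / (2 * Real.sin (Real.pi / (3 : ℕ)))) ^ 2 = 1 / 3 := by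
  have h := Real.sq_sqrt (show (0 : ℝ) ≤ 3 by norm_num)
  push_cast
  rw [Real.sin_pi_div_three, div_pow, mul_pow, div_pow, h]
  norm_num

theorem sin_sq_pi_div_five : Real.sin (Real.pi / 5) ^ 2 = (5 - √5) / 8 := by
  have h := Real.sq_sqrt (show (0 : ℝ) ≤ 5 by norm_num)
  rw [Real.sin_sq, Real.cos_pi_div_five]
  linear_combination (-1 / 16) * h

theorem radius_sq_five : (1 / (2 * Real.sin (Real.pi / (5 : ℕ)))) ^ 2 = (5 + √5) / 10 := by
  have h := Real.sq_sqrt (show (0 : ℝ) ≤ 5 by norm_num)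
  have h5 : √5 < 5 := by nlinarith [Real.sqrt_nonneg 5]
  push_cast
  rw [div_pow, mul_pow, sin_sq_pi_div_five]
  have : (5 - √5) ≠ 0 := by linarith
  field_simp
  linear_combination 4 * h

theorem sqrt_five_bounds : 2.236 < √5 ∧ √5 < 2.237 :=
  ⟨Real.lt_sqrt_of_sq_lt (by norm_num), (Real.sqrt_lt' (by norm_num)).2 (by norm_num)⟩

theorem cos_two_pi_div_three : Real.cos (2 * Real.pi / 3) = -1 / 2 := by
  rw [show 2 * Real.pi / 3 = Real.pi - Real.pi / 3 by ring, Real.cos_pi_sub,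
    Real.cos_pi_div_three]
  norm_num

theorem dist_polygonCorner_three {i j : Fin 3} (h : i ≠ j) :
    dist (polygonCorner 3 i) (polygonCorner 3 j) = 1 := by
  have key : Real.cos (2 * Real.pi * (i : ℕ) / (3 : ℕ) - 2 * Real.pi * (j : ℕ) / (3 : ℕ))
      = -1 / 2 := by
    -- Distinct indices differ by ±1, or by ±2 when the difference wraps around; the cosine is even
    -- and 2π-periodic, so all cases give the same value.
    have c : (i : ℕ) = j + 1 ∨ (j : ℕ) = i + 1 ∨ (i : ℕ) = j + 2 ∨ (j : ℕ) = i + 2 := by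
      revert i j; decide
    rw [← cos_two_pi_div_three]
    rcases c with c | c | c | c <;> rw [c] <;> push_cast
    · congr 1; ring
    · rw [← Real.cos_neg]; congr 1; ring
    · rw [← Real.cos_two_pi_sub]; congr 1; ring
    · rw [← Real.cos_two_pi_sub, ← Real.cos_neg, ← Real.cos_add_two_pi, ← Real.cos_add_two_pi]
      congr 1; ring
  have h2 := dist_sq_polygonCorner 3 i j
  rw [key, radius_sq_three] at h2
  exact (pow_eq_one_iff_of_nonneg dist_nonneg two_ne_zero).1 (by rw [h2]; norm_num)

theorem cos_two_pi_div_five : Real.cos (2 * Real.pi / 5) = (√5 - 1) / 4 := by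
  have h := Real.sq_sqrt (show (0 : ℝ) ≤ 5 by norm_num)
  rw [show 2 * Real.pi / 5 = 2 * (Real.pi / 5) by ring, Real.cos_two_mul, Real.cos_pi_div_five]
  linear_combination (1 / 8) * h

theorem cos_four_pi_div_five : Real.cos (4 * Real.pi / 5) = -(√5 + 1) / 4 := by
  rw [show 4 * Real.pi / 5 = Real.pi - Real.pi / 5 by ring, Real.cos_pi_sub, Real.cos_pi_div_five]
  ring

theorem dist_polygonCorner_five_of_adj {i j : Fin 5}
    (h : (SimpleGraph.cycleGraph 5).Adj i j) :
    dist (polygonCorner 5 i) (polygonCorner 5 j) = 1 := by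
  have key : Real.cos (2 * Real.pi * (i : ℕ) / (5 : ℕ) - 2 * Real.pi * (j : ℕ) / (5 : ℕ))
      = (√5 - 1) / 4 := by
    have c : (i : ℕ) = j + 1 ∨ (j : ℕ) = i + 1 ∨ (i : ℕ) = j + 4 ∨ (j : ℕ) = i + 4 := by
      revert i j; decide
    rw [← cos_two_pi_div_five]
    rcases c with c | c | c | c <;> rw [c] <;> push_cast
    · congr 1; ring
    · rw [← Real.cos_neg]; congr 1; ring
    · rw [← Real.cos_two_pi_sub]; congr 1; ring
    · rw [← Real.cos_two_pi_sub, ← Real.cos_neg, ← Real.cos_add_two_pi, ← Real.cos_add_two_pi]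
      congr 1; ring
  have h2 := dist_sq_polygonCorner 5 i j
  rw [key, radius_sq_five] at h2
  have hs := Real.sq_sqrt (show (0 : ℝ) ≤ 5 by norm_num)
  exact (pow_eq_one_iff_of_nonneg dist_nonneg two_ne_zero).1
    (by rw [h2]; linear_combination (-1 / 20) * hs)

theorem dist_sq_polygonCorner_five_of_not_adj {i j : Fin 5} (hne : i ≠ j)
    (h : ¬ (SimpleGraph.cycleGraph 5).Adj i j) :
    dist (polygonCorner 5 i) (polygonCorner 5 j) ^ 2 = (3 + √5) / 2 := by
  have key : Real.cos (2 * Real.pi * (i : ℕ) / (5 : ℕ) - 2 * Real.pi * (j : ℕ) / (5 : ℕ))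
      = -(√5 + 1) / 4 := by
    have c : (i : ℕ) = j + 2 ∨ (j : ℕ) = i + 2 ∨ (i : ℕ) = j + 3 ∨ (j : ℕ) = i + 3 := by
      revert i j; decide
    rw [← cos_four_pi_div_five]
    rcases c with c | c | c | c <;> rw [c] <;> push_cast
    · congr 1; ring
    · rw [← Real.cos_neg]; congr 1; ring
    · rw [← Real.cos_two_pi_sub]; congr 1; ring
    · rw [← Real.cos_two_pi_sub, ← Real.cos_neg, ← Real.cos_add_two_pi, ← Real.cos_add_two_pi]
      congr 1; ring
  rw [dist_sq_polygonCorner, key, radius_sq_five]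
  have hs := Real.sq_sqrt (show (0 : ℝ) ≤ 5 by norm_num)
  linear_combination (1 / 20) * hs

/-- Stewart's theorem in an inner product space. -/
theorem dist_lineMap_sq {E : Type*} [NormedAddCommGroup E] [InnerProductSpace ℝ E]
    (a b c : E) (s : ℝ) :
    dist (AffineMap.lineMap a b s) c ^ 2 =
      (1 - s) * dist a c ^ 2 + s * dist b c ^ 2 - s * (1 - s) * dist a b ^ 2 := by
  have e1 : AffineMap.lineMap a b s - c = (1 - s) • (a - c) + s • (b - c) := by
    rw [AffineMap.lineMap_apply_module]; module
  have e2 : a - b = (a - c) - (b - c) := by abel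
  rw [dist_eq_norm, dist_eq_norm, dist_eq_norm, dist_eq_norm, e1, e2]
  generalize a - c = x
  generalize b - c = y
  rw [ norm_add_sq_real, norm_sub_sq_real, norm_smul, norm_smul, inner_smul_left,
    inner_smul_right, mul_pow, mul_pow, Real.norm_eq_abs, Real.norm_eq_abs, sq_abs, sq_abs]
  simp only [conj_trivial]
  ring

theorem dist_lineMap_lineMap_half_sq {E : Type*} [NormedAddCommGroup E] [InnerProductSpace ℝ E]
    (a b c d : E) (s : ℝ) :
    dist (AffineMap.lineMap a b s) (AffineMap.lineMap c d (1 / 2 : ℝ)) ^ 2 =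
      (1 - s) / 2 * (dist a c ^ 2 + dist a d ^ 2) + s / 2 * (dist b c ^ 2 + dist b d ^ 2) -
        s * (1 - s) * dist a b ^ 2 - dist c d ^ 2 / 4 := by
  rw [dist_lineMap_sq, dist_comm a (AffineMap.lineMap c d _), dist_comm b (AffineMap.lineMap c d _),
    dist_lineMap_sq, dist_lineMap_sq, dist_comm c a, dist_comm d a, dist_comm c b, dist_comm d b]
  ring

/-- The metric properties of a polygon with unit sides that are needed below: corners are far from
the sides which do not contain them, and midpoints of sides are far from the other sides. -/
structure IsRoundPolygon {n : ℕ} [NeZero n] (c : Fin n → ℂ) : Prop where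
  dist_succ : ∀ i, dist (c i) (c (i + 1)) = 1
  one_le_dist : ∀ i j, i ≠ j → 1 ≤ dist (c i) (c j)
  corner_far : ∀ i k, k ≠ i → k ≠ i + 1 → ∀ s ∈ Set.Icc (0 : ℝ) 1,
    0.86 ≤ dist (AffineMap.lineMap (c i) (c (i + 1)) s) (c k)
  midpoint_far : ∀ i j, i ≠ j → ∀ s ∈ Set.Icc (0 : ℝ) 1,
    0.43 ≤ dist (AffineMap.lineMap (c i) (c (i + 1)) s)
      (AffineMap.lineMap (c j) (c (j + 1)) (1 / 2 : ℝ))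

/-- The triangle is the tight case: an altitude has length √3/2 ≈ 0.866, and the midpoint of a side
is √3/4 ≈ 0.433 away from the other sides. The constants 0.86 and 0.43 are these values rounded
down. -/
theorem isRoundPolygon_three : IsRoundPolygon (polygonCorner 3) where
  dist_succ i := dist_polygonCorner_three (by revert i; decide)
  one_le_dist i j h := (dist_polygonCorner_three h).ge
  corner_far i k h1 h2 s hs := by
    refine le_of_sq_le_sq ?_ dist_nonneg
    rw [dist_lineMap_sq, dist_polygonCorner_three h1.symm, dist_polygonCorner_three h2.symm,
      dist_polygonCorner_three (show i ≠ i + 1 by clear * - i; revert i; decide)]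
    nlinarith [sq_nonneg (s - 1 / 2)]
  midpoint_far i j h s hs := by
    refine le_of_sq_le_sq ?_ dist_nonneg
    rw [dist_lineMap_lineMap_half_sq]
    have c : j = i + 1 ∨ j = i + 2 := by revert i j; decide
    have h01 := dist_polygonCorner_three (show i ≠ i + 1 by clear * - i; revert i; decide)
    have h02 := dist_polygonCorner_three (show i ≠ i + 2 by clear * - i; revert i; decide)
    have h12 := dist_polygonCorner_three (show i + 1 ≠ i + 2 by clear * - i; revert i; decide)
    rcases c with rfl | rfl
    · rw [show i + 1 + 1 = i + 2 by clear * - i; revert i; decide, h01, h02, h12, dist_self]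
      nlinarith [sq_nonneg (s - 3 / 4)]
    · rw [show i + 2 + 1 = i by clear * - i; revert i; decide, dist_comm _ (polygonCorner 3 i),
        dist_comm (polygonCorner 3 (i + 1)) (polygonCorner 3 i),
        dist_comm (polygonCorner 3 (i + 2)) (polygonCorner 3 i), h01, h02, h12, dist_self]
      nlinarith [sq_nonneg (s - 1 / 4)]

/-- The bounds have slack here: interior angles are obtuse, so the true minima are 1 and 1/2,
attained at corners. Up to rotation only the index difference matters, and each case is a quadratic
inequality in `s` by Stewart's theorem. -/
theorem isRoundPolygon_five : IsRoundPolygon (polygonCorner 5) where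
  dist_succ i := dist_polygonCorner_five_of_adj (by revert i; decide)
  one_le_dist i j h := by
    by_cases hij : (SimpleGraph.cycleGraph 5).Adj i j
    · exact (dist_polygonCorner_five_of_adj hij).ge
    · refine le_of_sq_le_sq ?_ dist_nonneg
      rw [dist_sq_polygonCorner_five_of_not_adj h hij]
      linarith [sqrt_five_bounds.1]
  corner_far i k h1 h2 s hs := by
    obtain ⟨hs0, hs1⟩ := hs
    refine le_of_sq_le_sq ?_ dist_nonneg
    have c : k = i + 2 ∨ k = i + 3 ∨ k = i + 4 := by revert i k; decide
    have h01 := dist_polygonCorner_five_of_adj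
      (show (SimpleGraph.cycleGraph 5).Adj i (i + 1) by clear * - i; revert i; decide)
    have hφ := sqrt_five_bounds.1
    rw [dist_lineMap_sq, h01]
    rcases c with rfl | rfl | rfl
    · rw [dist_polygonCorner_five_of_adj (i := i + 1) (by clear * - i; revert i; decide),
        dist_sq_polygonCorner_five_of_not_adj (i := i) (by clear * - i; revert i; decide)
          (by clear * - i; revert i; decide)]
      nlinarith [sq_nonneg s]
    · rw [dist_sq_polygonCorner_five_of_not_adj (i := i) (by clear * - i; revert i; decide)
          (by clear * - i; revert i; decide),
        dist_sq_polygonCorner_five_of_not_adj (i := i + 1) (by clear * - i; revert i; decide)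
          (by clear * - i; revert i; decide)]
      nlinarith [sq_nonneg s]
    · rw [dist_polygonCorner_five_of_adj (i := i) (by clear * - i; revert i; decide),
        dist_sq_polygonCorner_five_of_not_adj (i := i + 1) (by clear * - i; revert i; decide)
          (by clear * - i; revert i; decide)]
      nlinarith [sq_nonneg s]
  midpoint_far i j h s hs := by
    obtain ⟨hs0, hs1⟩ := hs
    refine le_of_sq_le_sq ?_ dist_nonneg
    have adj : ∀ i j, (SimpleGraph.cycleGraph 5).Adj i j →
        dist (polygonCorner 5 i) (polygonCorner 5 j) ^ 2 = 1 := fun i j h => by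
      rw [dist_polygonCorner_five_of_adj h, one_pow]
    have diag : ∀ i j, i ≠ j ∧ ¬ (SimpleGraph.cycleGraph 5).Adj i j →
        dist (polygonCorner 5 i) (polygonCorner 5 j) ^ 2 = (3 + √5) / 2 := fun i j h =>
      dist_sq_polygonCorner_five_of_not_adj h.1 h.2
    have c : j = i + 1 ∨ j = i + 2 ∨ j = i + 3 ∨ j = i + 4 := by revert i j; decide
    have hφ := sqrt_five_bounds.1
    rw [dist_lineMap_lineMap_half_sq, adj i (i + 1) (by clear * - i; revert i; decide),
      adj j (j + 1) (by clear * - j; revert j; decide)]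
    rcases c with rfl | rfl | rfl | rfl
    · rw [adj i (i + 1) (by clear * - i; revert i; decide),
        diag i (i + 1 + 1) (by clear * - i; revert i; decide),
        adj (i + 1) (i + 1 + 1) (by clear * - i; revert i; decide), dist_self]
      nlinarith [sq_nonneg (s - 1)]
    · rw [diag i (i + 2) (by clear * - i; revert i; decide),
        diag i (i + 2 + 1) (by clear * - i; revert i; decide),
        adj (i + 1) (i + 2) (by clear * - i; revert i; decide),
        diag (i + 1) (i + 2 + 1) (by clear * - i; revert i; decide)]
      nlinarith [sq_nonneg (s - 1 / 2)]
    · rw [diag i (i + 3) (by clear * - i; revert i; decide),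
        adj i (i + 3 + 1) (by clear * - i; revert i; decide),
        diag (i + 1) (i + 3) (by clear * - i; revert i; decide),
        diag (i + 1) (i + 3 + 1) (by clear * - i; revert i; decide)]
      nlinarith [sq_nonneg (s - 1 / 2)]
    · rw [show i + 4 + 1 = i by clear * - i; revert i; decide,
        adj i (i + 4) (by clear * - i; revert i; decide),
        diag (i + 1) (i + 4) (by clear * - i; revert i; decide),
        adj (i + 1) i (by clear * - i; revert i; decide),
        dist_self]
      nlinarith [sq_nonneg s]

/-! ### Circumradius and inradius of the pentagon -/

theorem norm_sq_polygonCorner_five (i : Fin 5) :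
    ‖polygonCorner 5 i‖ ^ 2 = (5 + √5) / 10 := by
  rw [norm_sq_polygonCorner, radius_sq_five]

/-- The circumradius is about 0.851. The weaker bound √3/2 makes two corners of a pentagon at most
√3 apart via its centre, the same bound as for the far vertices of two triangles sharing an edge. -/
theorem dist_zero_polygonCorner_five_le (i : Fin 5) :
    dist 0 (polygonCorner 5 i) ≤ √3 / 2 := by
  rw [dist_zero_left]
  refine le_of_sq_le_sq ?_ (by positivity)
  rw [norm_sq_polygonCorner_five, div_pow, Real.sq_sqrt (by norm_num)]
  linarith [sqrt_five_bounds.2]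

/-- The inradius is about 0.688. -/
theorem le_dist_lineMap_zero_five (i : Fin 5) (s : ℝ) :
    2 / 3 ≤ dist (AffineMap.lineMap (polygonCorner 5 i) (polygonCorner 5 (i + 1)) s) 0 := by
  refine le_of_sq_le_sq ?_ dist_nonneg
  rw [dist_lineMap_sq, dist_zero_right, dist_zero_right, norm_sq_polygonCorner_five,
    norm_sq_polygonCorner_five, isRoundPolygon_five.dist_succ]
  nlinarith [sq_nonneg (s - 1 / 2), sqrt_five_bounds.1]

theorem polygonCorner_mem_solidPolygon (n : ℕ) (i : Fin n) :
    polygonCorner n i ∈ solidPolygon n :=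
  subset_convexHull _ _ ⟨i, rfl⟩

theorem zero_mem_solidPolygon_five : (0 : ℂ) ∈ solidPolygon 5 := by
  have hsum : ∑ i : Fin 5, (1 / 5 : ℝ) • polygonCorner 5 i = 0 := by
    -- The centre is the average of the corners, because the fifth roots of unity sum to zero.
    have hζ := (Complex.isPrimitiveRoot_exp 5 (by norm_num)).geom_sum_eq_zero (by norm_num)
    have hexp : ∑ i : Fin 5,
        Complex.exp (((2 * Real.pi * (i : ℕ) / (5 : ℕ) : ℝ) : ℂ) * Complex.I) = 0 := by
      rw [← hζ, Finset.sum_range]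
      refine Finset.sum_congr rfl fun i _ => ?_
      rw [← Complex.exp_nat_mul]
      congr 1
      push_cast
      ring
    simp only [polygonCorner]
    rw [← Finset.smul_sum, ← Finset.mul_sum, hexp, mul_zero, smul_zero]
  rw [← hsum]
  exact (convex_convexHull ℝ _).sum_mem (fun _ _ => by norm_num) (by simp)
    fun i _ => polygonCorner_mem_solidPolygon 5 i

/-! ### Distance inequalities in CAT(0) spaces -/

/-- A Euclidean triangle with prescribed side lengths. -/
theorem exists_comparison_triangle {a b c : ℝ} (ha : 0 < a) (hb : 0 ≤ b) (hc : 0 ≤ c)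
    (h1 : a ≤ b + c) (h2 : b ≤ a + c) (h3 : c ≤ a + b) :
    ∃ p q r : EuclideanSpace ℝ (Fin 2), dist p q = a ∧ dist p r = b ∧ dist q r = c := by
  set x := (a ^ 2 + b ^ 2 - c ^ 2) / (2 * a) with hx
  have hx' : 2 * a * x = a ^ 2 + b ^ 2 - c ^ 2 := by rw [hx]; field_simp
  have hy : 0 ≤ b ^ 2 - x ^ 2 := by
    have h4 : 0 ≤ (2 * a) ^ 2 * (b ^ 2 - x ^ 2) := by
      -- Heron's formula: the squared height is a product of factors that are nonnegative by the
      -- triangle inequalities.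
      have e : (2 * a) ^ 2 * (b ^ 2 - x ^ 2) =
          (a + b + c) * (a + b - c) * ((a + c - b) * (b + c - a)) := by
        linear_combination (-(2 * a * x) - (a ^ 2 + b ^ 2 - c ^ 2)) * hx'
      rw [e]
      have := sub_nonneg.2 h1
      have := sub_nonneg.2 h2
      have := sub_nonneg.2 h3
      positivity
    exact nonneg_of_mul_nonneg_right h4 (by positivity)
  have hs := Real.sq_sqrt hy
  refine ⟨!₂[0, 0], !₂[a, 0], !₂[x, √(b ^ 2 - x ^ 2)],
    (pow_left_inj₀ dist_nonneg ha.le two_ne_zero).1 ?_,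
    (pow_left_inj₀ dist_nonneg hb two_ne_zero).1 ?_,
    (pow_left_inj₀ dist_nonneg hc two_ne_zero).1 ?_⟩ <;>
    rw [EuclideanSpace.dist_eq, Real.sq_sqrt (by positivity)] <;>
    simp only [Fin.sum_univ_two, Real.dist_eq, sq_abs] <;> simp
  · linarith
  · linear_combination hs - hx'

namespace IsCATZero

variable {M : Type*} [PseudoEMetricSpace M]

theorem edist_ne_top (hM : IsCATZero M) (x y : M) : edist x y ≠ ⊤ := by
  obtain ⟨L, γ, h0, hx, hy, h⟩ := hM.1 x y
  rw [← hx, ← hy, h 0 ⟨le_rfl, h0⟩ L ⟨h0, le_rfl⟩]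
  exact ENNReal.ofReal_ne_top

/-- A CAT(0) space, as a space with real-valued distances. -/
noncomputable abbrev toPseudoMetricSpace (hM : IsCATZero M) : PseudoMetricSpace M :=
  PseudoEMetricSpace.toPseudoMetricSpace hM.edist_ne_top

end IsCATZero

section PseudoMetricSpace

variable {M : Type*} [PseudoMetricSpace M]

theorem IsGeodesicPath.dist_eq {γ : ℝ → M} {L : ℝ} {x y : M} (h : IsGeodesicPath γ L x y) :
    dist x y = L := by
  obtain ⟨h0, hx, hy, h⟩ := h
  have := h 0 ⟨le_rfl, h0⟩ L ⟨h0, le_rfl⟩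
  rw [hx, hy, zero_sub, abs_neg, abs_of_nonneg h0] at this
  rw [dist_edist, this, ENNReal.toReal_ofReal h0]

/-- The CAT(0) inequality for a vertex of a triangle and a point of the opposite side. -/
theorem IsCATZero.dist_sq_le (hM : IsCATZero M) {α : ℝ → M} {a : ℝ} {x y : M}
    (hα : IsGeodesicPath α a x y) (z : M) {t : ℝ} (ht : t ∈ Set.Icc (0 : ℝ) 1) :
    dist (α (t * a)) z ^ 2 ≤
      (1 - t) * dist x z ^ 2 + t * dist y z ^ 2 - t * (1 - t) * a ^ 2 := by
  have hxy := hα.dist_eq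
  obtain ⟨h0, hx, hy, -⟩ := id hα
  rcases h0.eq_or_lt with rfl | ha
  · have h : dist y z = dist x z := le_antisymm
      (by linarith [dist_triangle y x z, dist_comm x y]) (by linarith [dist_triangle x y z])
    rw [mul_zero, hx, h]
    exact le_of_eq (by ring)
  obtain ⟨b, β, hβ⟩ := hM.1 x z
  obtain ⟨c, γ, hγ⟩ := hM.1 y z
  have hb := hβ.dist_eq
  have hc := hγ.dist_eq
  have h1 := dist_triangle x z y
  have h2 := dist_triangle x y z
  have h3 := dist_triangle y x z
  rw [dist_comm z y] at h1
  rw [dist_comm y x] at h3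
  obtain ⟨p, q, r, hpq, hpr, hqr⟩ := exists_comparison_triangle ha hβ.1 hγ.1
    (by linarith) (by linarith) (by linarith)
  have hta : t * a ∈ Set.Icc 0 a := ⟨mul_nonneg ht.1 h0, mul_le_of_le_one_left h0 ht.2⟩
  -- The second point is the far end `z` of `β`, whose comparison point is the corner `r`.
  have key := hM.2 x y z a b c α β γ hα hβ hγ p q r hpq hpr hqr (t * a) hta b ⟨hβ.1, le_rfl⟩
    (AffineMap.lineMap p q t) (by rw [segment_eq_image_lineMap]; exact ⟨t, ht, rfl⟩)
    r (right_mem_segment ℝ p r)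
    (by rw [dist_left_lineMap, hpq, Real.norm_eq_abs, abs_of_nonneg ht.1]) hpr
  rw [hβ.2.2.1, edist_dist, edist_dist, ENNReal.ofReal_le_ofReal_iff dist_nonneg] at key
  calc dist (α (t * a)) z ^ 2 ≤ dist (AffineMap.lineMap p q t) r ^ 2 := by gcongr
    _ = _ := by rw [dist_lineMap_sq, hpq, hpr, hqr, hb, hc]

/-- The CAT(0) inequality for the midpoint of a side. -/
theorem IsCATZero.dist_midpoint_sq_le (hM : IsCATZero M) {α : ℝ → M} {a : ℝ} {x y : M}
    (hα : IsGeodesicPath α a x y) (z : M) :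
    dist (α (a / 2)) z ^ 2 ≤ dist x z ^ 2 / 2 + dist y z ^ 2 / 2 - a ^ 2 / 4 := by
  have := hM.dist_sq_le hα z (t := 1 / 2) (by norm_num)
  rw [show 1 / 2 * a = a / 2 by ring] at this
  linarith

/-- The sum of the squares of the diagonals of a quadrilateral is at most the sum of the squares
of the sides. -/
theorem IsCATZero.diagonals_sq_le (hM : IsCATZero M) (x y z w : M) :
    dist x z ^ 2 + dist y w ^ 2 ≤
      dist x y ^ 2 + dist y z ^ 2 + dist z w ^ 2 + dist w x ^ 2 := by
  obtain ⟨a, α, hα⟩ := hM.1 x z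
  have h1 := hM.dist_midpoint_sq_le hα y
  have h2 := hM.dist_midpoint_sq_le hα w
  have h3 := dist_triangle_left y w (α (a / 2))
  have h4 : dist y w ^ 2 ≤ (dist (α (a / 2)) y + dist (α (a / 2)) w) ^ 2 := by gcongr
  rw [hα.dist_eq, dist_comm y z, dist_comm w x]
  nlinarith [sq_nonneg (dist (α (a / 2)) y - dist (α (a / 2)) w)]

/-- The Berg–Nikolaev quadrilateral inequality, with the mixed term `2 * dist y z * dist x w`
replaced by an upper bound. -/
theorem IsCATZero.diagonals_sq_le' (hM : IsCATZero M) (x y z w : M) :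
    dist x z ^ 2 + dist y w ^ 2 ≤
      dist x y ^ 2 + dist z w ^ 2 + 2 * dist y z ^ 2 + dist x w ^ 2 / 2 := by
  obtain ⟨a, α, hα⟩ := hM.1 x z
  -- The point dividing the diagonal in the ratio 2 : 1 is where the diagonals of a Euclidean
  -- trapezoid cross when the side `xw` is parallel to `yz` and twice as long. There 2·|yz|·|xw|
  -- equals 2|yz|² + |xw|²/2.
  have h1 := hM.dist_sq_le hα y (t := 2 / 3) (by norm_num)
  have h2 := hM.dist_sq_le hα w (t := 2 / 3) (by norm_num)
  have h3 := dist_triangle_left y w (α (2 / 3 * a))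
  have h4 : dist y w ^ 2 ≤ (dist (α (2 / 3 * a)) y + dist (α (2 / 3 * a)) w) ^ 2 := by gcongr
  rw [hα.dist_eq, dist_comm y z]
  -- With p, q the distances from the division point to `y` and `w`, this is (p + q)² ≤ 3p² +
  -- (3/2)q², with equality for q = 2p. These weights make the terms in `a ^ 2` add up to exactly
  -- `-a ^ 2`.
  nlinarith [sq_nonneg (dist (α (2 / 3 * a)) y - dist (α (2 / 3 * a)) w / 2)]

end PseudoMetricSpace

/-! ### Tent functions and lower bounds for the intrinsic metric -/

/-- The function `max 0 (r - dist z c)`, for an optional centre `c`; without a centre it is `0`. -/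
noncomputable def tent {E : Type*} [PseudoMetricSpace E] (r : ℝ) (c : Option E) (z : E) : ℝ :=
  c.elim 0 fun c => max 0 (r - dist z c)

section tent

variable {E : Type*} [PseudoMetricSpace E]

@[simp] theorem tent_none (r : ℝ) (z : E) : tent r none z = 0 := rfl

@[simp] theorem tent_some (r : ℝ) (c z : E) : tent r (some c) z = max 0 (r - dist z c) := rfl

theorem tent_nonneg (r : ℝ) (c : Option E) (z : E) : 0 ≤ tent r c z := by
  cases c <;> simp

theorem tent_sub_tent_le (r : ℝ) (c : Option E) (z w : E) : tent r c z - tent r c w ≤ dist z w := by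
  cases c with
  | none => simp
  | some c =>
    have h1 := le_max_left 0 (r - dist w c)
    have h2 := le_max_right 0 (r - dist w c)
    have h3 := dist_triangle_left w c z
    rcases max_choice 0 (r - dist z c) with h | h <;> rw [tent_some, tent_some, h]
    · linarith [dist_nonneg (x := z) (y := w)]
    · linarith

/-- The only case not covered by one tent being 1-Lipschitz is `z` under the first tent and `w`
under the second. Then the heights add up to r₁ + r₂ - d(z,a) - d(w,b), which is at most d(z,w)
because the apexes are r₁ + r₂ apart. -/
theorem tent_add_tent_le {r₁ r₂ : ℝ} {c₁ c₂ : Option E}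
    (h : ∀ a ∈ c₁, ∀ b ∈ c₂, r₁ + r₂ ≤ dist a b) (z w : E) :
    tent r₁ c₁ z - tent r₂ c₂ z - (tent r₁ c₁ w - tent r₂ c₂ w) ≤ dist z w := by
  have h1 := tent_sub_tent_le r₁ c₁ z w
  have h2 := tent_sub_tent_le r₂ c₂ w z
  rw [dist_comm] at h2
  have h3 := tent_nonneg r₁ c₁ w
  have h4 := tent_nonneg r₂ c₂ z
  cases c₁ with
  | none => simp only [tent_none]; linarith
  | some a =>
    cases c₂ with
    | none => simp only [tent_none]; linarith
    | some b =>
      have hab := h a rfl b rfl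
      have h5 := dist_triangle4 a z w b
      have h6 := dist_comm a z
      simp only [tent_some] at h1 h2 h3 h4 ⊢
      rcases max_choice 0 (r₁ - dist z a) with e | e
      · linarith
      · rcases max_choice 0 (r₂ - dist w b) with e' | e'
        · linarith
        · linarith

end tent

namespace TrianglePentagonComplex

variable {V T P : Type*} {X : TrianglePentagonComplex V T P}

variable (X) in
/-- A choice of at most one marked point in each cell of `X`. -/
structure Marking where
  vert : V → Option ℝ
  edge : X.graph.Dart → Option ℝ
  tri : T → Option ℂ
  pent : P → Option ℂ

/-- The tent function of radius `r` of a marking. -/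
noncomputable def Marking.height (m : X.Marking) (r : ℝ) : X.CellPoint → ℝ
  | .vertex v => tent r (m.vert v) 0
  | .edge e s => tent r (m.edge e) s
  | .tri t z => tent r (m.tri t) z
  | .pent p z => tent r (m.pent p) z

/-- The tent function of radius `r` respects the gluing of the cells. -/
def Marking.Compatible (m : X.Marking) (r : ℝ) : Prop :=
  ∀ a b, X.Glue a b → m.height r a = m.height r b

/-- In each cell, the points marked by `m₁` and `m₂` have distance at least `l`. -/
structure Marking.Separated (m₁ m₂ : X.Marking) (l : ℝ) : Prop where
  edge : ∀ e, ∀ a ∈ m₁.edge e, ∀ b ∈ m₂.edge e, l ≤ dist a b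
  tri : ∀ t, ∀ a ∈ m₁.tri t, ∀ b ∈ m₂.tri t, l ≤ dist a b
  pent : ∀ p, ∀ a ∈ m₁.pent p, ∀ b ∈ m₂.pent p, l ≤ dist a b

theorem CellString.le_of_lipschitz {F : X.Realization → ℝ}
    (hF : ∀ x y l, X.CellStep x y l → F x - F y ≤ l) {x y : X.Realization} {l : ℝ}
    (h : X.CellString x y l) : F x - F y ≤ l := by
  induction h with
  | nil => simp
  | cons h _ ih => linarith [hF _ _ _ h]

/-- The difference of the two heights descends to the glued space, is 1-Lipschitz along every
string, and falls from `r₁` at `a` to `-r₂` at `b`. -/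
theorem Marking.ofReal_le_edist {m₁ m₂ : X.Marking} {r₁ r₂ : ℝ} (h₁ : m₁.Compatible r₁)
    (h₂ : m₂.Compatible r₂) (h : m₁.Separated m₂ (r₁ + r₂)) {a b : X.CellPoint}
    (ha : m₁.height r₁ a = r₁) (ha' : m₂.height r₂ a = 0) (hb : m₁.height r₁ b = 0)
    (hb' : m₂.height r₂ b = r₂) :
    ENNReal.ofReal (r₁ + r₂) ≤ edist (α := X.Realization) (Quot.mk _ a) (Quot.mk _ b) := by
  let F : X.Realization → ℝ := Quot.lift (fun c => m₁.height r₁ c - m₂.height r₂ c)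
    fun c d hcd => by rw [h₁ c d hcd, h₂ c d hcd]
  have hF : ∀ x y l, X.CellStep x y l → F x - F y ≤ l := by
    intro x y l hl
    cases hl with
    | edge e s t => exact tent_add_tent_le (h.edge e) (s : ℝ) (t : ℝ)
    | tri t z w => exact tent_add_tent_le (h.tri t) (z : ℂ) (w : ℂ)
    | pent p z w => exact tent_add_tent_le (h.pent p) (z : ℂ) (w : ℂ)
  refine le_iInf₂ fun l hl => ENNReal.ofReal_le_ofReal ?_
  have := hl.le_of_lipschitz hF
  have e : F (Quot.mk X.Glue a) - F (Quot.mk X.Glue b) = r₁ + r₂ := by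
    change m₁.height r₁ a - m₂.height r₂ a - (m₁.height r₁ b - m₂.height r₂ b) = r₁ + r₂
    rw [ha, ha', hb, hb']; ring
  linarith

/-! #### The marking of a vertex -/

open Classical in
/-- The ends of the edge `e` which are equal to `u`. -/
noncomputable def edgeEnd (u : V) (e : X.graph.Dart) : Option ℝ :=
  if e.fst = u then some 0 else if e.snd = u then some 1 else none

open Classical in
/-- The corner of an `n`-gon with vertices `f` at which `u` is placed. -/
noncomputable def cornerAt {n : ℕ} (f : Fin n → V) (u : V) : Option ℂ :=
  if h : ∃ i, f i = u then some (polygonCorner n h.choose) else none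

theorem cornerAt_apply {n : ℕ} {f : Fin n → V} (hf : Function.Injective f) (i : Fin n) :
    cornerAt f (f i) = some (polygonCorner n i) := by
  have h : ∃ j, f j = f i := ⟨i, rfl⟩
  rw [cornerAt, dif_pos h, hf h.choose_spec]

theorem mem_cornerAt {n : ℕ} {f : Fin n → V} {u : V} {z : ℂ} (h : z ∈ cornerAt f u) :
    ∃ i, f i = u ∧ z = polygonCorner n i := by
  rw [cornerAt] at h
  split_ifs at h with h'
  · exact ⟨_, h'.choose_spec, (Option.mem_some.1 h).symm⟩
  · cases h

variable (X) in
open Classical in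
/-- The marking of the vertex `u`. -/
noncomputable def vertexMarking (u : V) : X.Marking where
  vert v := if v = u then some 0 else none
  edge := edgeEnd u
  tri t := cornerAt (X.tri t) u
  pent p := cornerAt (X.pent p) u

/-- On a side ending at `u` the distance to the corner is the arc length along the edge; the other
sides are at least 0.86 away, so the tent vanishes there. This limits the radius of a vertex tent.
-/
theorem tent_cornerAt_lineMap {n : ℕ} [NeZero n] (hn : IsRoundPolygon (polygonCorner n))
    {f : Fin n → V} (hf : Function.Injective f) {r : ℝ} (hr : r ≤ 0.86) (u : V)
    (i : Fin n) (e : X.graph.Dart) (s : unitInterval)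
    (hfst : e.fst = f i) (hsnd : e.snd = f (i + 1)) :
    tent r (cornerAt f u)
      (AffineMap.lineMap (polygonCorner n i) (polygonCorner n (i + 1)) (s : ℝ)) =
        tent r (edgeEnd u e) (s : ℝ) := by
  by_cases h1 : e.fst = u
  · rw [edgeEnd, if_pos h1, ← h1, hfst, cornerAt_apply hf, tent_some, tent_some,
      dist_lineMap_left, hn.dist_succ, mul_one, Real.dist_eq, sub_zero, Real.norm_eq_abs]
  by_cases h2 : e.snd = u
  · rw [edgeEnd, if_neg h1, if_pos h2, ← h2, hsnd, cornerAt_apply hf, tent_some, tent_some,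
      dist_lineMap_right, hn.dist_succ, mul_one, Real.dist_eq, Real.norm_eq_abs, abs_sub_comm]
  rw [edgeEnd, if_neg h1, if_neg h2, tent_none]
  by_cases h : ∃ k, f k = u
  · obtain ⟨k, rfl⟩ := h
    rw [cornerAt_apply hf, tent_some, max_eq_left]
    have := hn.corner_far i k (fun h => h1 (by rw [hfst, h])) (fun h => h2 (by rw [hsnd, h])) s s.2
    linarith
  · rw [cornerAt, dif_neg h, tent_none]

theorem vertexMarking_compatible (u : V) {r : ℝ} (hr : r ≤ 0.86) :
    (X.vertexMarking u).Compatible r := by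
  intro a b h
  cases h with
  | start e =>
    simp only [Marking.height, vertexMarking, edgeEnd]
    split_ifs
    · simp
    · simp; linarith
    · simp
  | flip e s =>
    have hne : e.fst ≠ e.snd := e.adj.ne
    simp only [Marking.height, vertexMarking, edgeEnd]
    by_cases h1 : e.fst = u
    · have h2 : e.snd ≠ u := fun h => hne (h1.trans h.symm)
      simp [h1, h2, unitInterval.coe_symm_eq]
    · by_cases h2 : e.snd = u
      · simp [h1, h2, Real.dist_eq, unitInterval.coe_symm_eq, abs_sub_comm]
      · simp [h1, h2]
  | triSide t i e s z h1 h2 hz =>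
    simp only [Marking.height, vertexMarking, hz]
    exact tent_cornerAt_lineMap isRoundPolygon_three (X.tri t).injective hr u i e s h1 h2
  | pentSide p i e s z h1 h2 hz =>
    simp only [Marking.height, vertexMarking, hz]
    exact tent_cornerAt_lineMap isRoundPolygon_five (X.pent p).injective hr u i e s h1 h2

theorem vertexMarking_height_self (u : V) {r : ℝ} (hr : 0 ≤ r) :
    (X.vertexMarking u).height r (.vertex u) = r := by
  simp [Marking.height, vertexMarking, hr]

theorem vertexMarking_height_of_ne {u v : V} (h : v ≠ u) (r : ℝ) :
    (X.vertexMarking u).height r (.vertex v) = 0 := by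
  simp [Marking.height, vertexMarking, h]

/-! #### The marking of the midpoint of an edge -/

open Classical in
/-- The midpoint of the side of an `n`-gon with vertices `f` at which the edge `q` is placed. -/
noncomputable def midpointAt {n : ℕ} [NeZero n] (f : Fin n → V) (q : Sym2 V) : Option ℂ :=
  if h : ∃ i, s(f i, f (i + 1)) = q then
    some (AffineMap.lineMap (polygonCorner n h.choose) (polygonCorner n (h.choose + 1)) (1 / 2 : ℝ))
  else none

/-- The condition on `n` excludes the digon, whose two sides have the same pair of ends. -/
theorem side_injective {n : ℕ} [NeZero n] (hn : ∀ i : Fin n, i + 1 + 1 ≠ i) {f : Fin n → V}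
    (hf : Function.Injective f) : Function.Injective fun i => s(f i, f (i + 1)) := by
  intro i j h
  rcases Sym2.eq_iff.1 h with h | h
  · exact hf h.1
  · exact absurd (by rw [← hf h.1, hf h.2]) (hn j)

theorem midpointAt_apply {n : ℕ} [NeZero n] (hn : ∀ i : Fin n, i + 1 + 1 ≠ i) {f : Fin n → V}
    (hf : Function.Injective f) (i : Fin n) :
    midpointAt f s(f i, f (i + 1)) =
      some (AffineMap.lineMap (polygonCorner n i) (polygonCorner n (i + 1)) (1 / 2 : ℝ)) := by
  have h : ∃ j, s(f j, f (j + 1)) = s(f i, f (i + 1)) := ⟨i, rfl⟩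
  rw [midpointAt, dif_pos h, side_injective hn hf h.choose_spec]

theorem exists_of_mem_midpointAt {n : ℕ} [NeZero n] {f : Fin n → V} {q : Sym2 V} {z : ℂ}
    (h : z ∈ midpointAt f q) : ∃ i, s(f i, f (i + 1)) = q := by
  rw [midpointAt] at h
  split_ifs at h with h'
  · exact h'
  · cases h

variable (X) in
open Classical in
/-- The marking of the midpoint of the edge `q`. -/
noncomputable def midpointMarking (q : Sym2 V) : X.Marking where
  vert _ := none
  edge e := if e.edge = q then some (1 / 2) else none
  tri t := midpointAt (X.tri t) q
  pent p := midpointAt (X.pent p) q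

open Classical in
theorem tent_midpointAt_lineMap {n : ℕ} [NeZero n] (hn : IsRoundPolygon (polygonCorner n))
    (hn' : ∀ i : Fin n, i + 1 + 1 ≠ i)
    {f : Fin n → V} (hf : Function.Injective f) {r : ℝ} (hr : r ≤ 0.43) (q : Sym2 V)
    (i : Fin n) (e : X.graph.Dart) (s : unitInterval)
    (hfst : e.fst = f i) (hsnd : e.snd = f (i + 1)) :
    tent r (midpointAt f q)
      (AffineMap.lineMap (polygonCorner n i) (polygonCorner n (i + 1)) (s : ℝ)) =
        tent r (if e.edge = q then some (1 / 2) else none) (s : ℝ) := by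
  have he : e.edge = s(f i, f (i + 1)) := by rw [← hfst, ← hsnd]; rfl
  by_cases h1 : e.edge = q
  · rw [if_pos h1, ← h1, he, midpointAt_apply hn' hf, tent_some, tent_some,
      dist_lineMap_lineMap, hn.dist_succ, mul_one]
  rw [if_neg h1, tent_none]
  by_cases h : ∃ k, s(f k, f (k + 1)) = q
  · obtain ⟨k, rfl⟩ := h
    rw [midpointAt_apply hn' hf, tent_some, max_eq_left]
    have := hn.midpoint_far i k (fun h => h1 (by rw [he, h])) s s.2
    linarith
  · rw [midpointAt, dif_neg h, tent_none]

theorem midpointMarking_compatible (q : Sym2 V) {r : ℝ} (hr : r ≤ 0.43) :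
    (X.midpointMarking q).Compatible r := by
  intro a b h
  cases h with
  | start e =>
    simp only [Marking.height, midpointMarking]
    split_ifs
    · rw [tent_some, tent_none, max_eq_left]
      norm_num [Real.dist_eq]
      linarith
    · simp
  | flip e s =>
    simp only [Marking.height, midpointMarking]
    have he : e.symm.edge = e.edge := e.edge_symm
    by_cases h : e.edge = q
    · rw [if_pos h, if_pos (he.trans h)]
      rw [tent_some, tent_some, Real.dist_eq, Real.dist_eq, unitInterval.coe_symm_eq,
        abs_sub_comm]
      congr 3
      ring
    · rw [if_neg h, if_neg (he ▸ h)]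
      rfl
  | triSide t i e s z h1 h2 hz =>
    simp only [Marking.height, midpointMarking, hz]
    exact tent_midpointAt_lineMap isRoundPolygon_three (by decide) (X.tri t).injective hr q i e s
      h1 h2
  | pentSide p i e s z h1 h2 hz =>
    simp only [Marking.height, midpointMarking, hz]
    exact tent_midpointAt_lineMap isRoundPolygon_five (by decide) (X.pent p).injective hr q i e s
      h1 h2

/-! #### The marking of the centre of a pentagon -/

variable (X) in
open Classical in
/-- The marking of the centre of the pentagon `p`. -/
noncomputable def centerMarking (p : P) : X.Marking where
  vert _ := none
  edge _ := none
  tri _ := none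
  pent q := if q = p then some 0 else none

/-- A radius of at most 2/3 is below the inradius, so the tent vanishes on the boundary of the
pentagon and extends by zero. -/
theorem centerMarking_compatible (p : P) {r : ℝ} (hr : r ≤ 2 / 3) :
    (X.centerMarking p).Compatible r := by
  intro a b h
  cases h with
  | start e => rfl
  | flip e s => rfl
  | triSide t i e s z h1 h2 hz => rfl
  | pentSide q i e s z h1 h2 hz =>
    simp only [Marking.height, centerMarking, hz, tent_none]
    split_ifs
    · rw [tent_some, max_eq_left]
      linarith [le_dist_lineMap_zero_five i s]
    · rfl

/-! #### Distances in `X` -/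

variable (X) in
/-- The vertex `v`, as a point of the space underlying `X`. -/
def vertexPoint (v : V) : X.Realization := Quot.mk _ (.vertex v)

variable (X) in
/-- The centre of the pentagon `p`, as a point of the space underlying `X`. -/
def centerPoint (p : P) : X.Realization := Quot.mk _ (.pent p ⟨0, zero_mem_solidPolygon_five⟩)

variable (X) in
/-- The edge `e`, as a path parametrized by arc length. -/
noncomputable def edgePath (e : X.graph.Dart) (s : ℝ) : X.Realization :=
  Quot.mk _ (.edge e (Set.projIcc 0 1 zero_le_one s))

theorem edist_le_of_cellStep {x y : X.Realization} {l : ℝ} (h : X.CellStep x y l) :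
    edist x y ≤ ENNReal.ofReal l := by
  refine (iInf₂_le (l + 0) (.cons h (.nil y))).trans ?_
  rw [add_zero]

/-! ### Lower bounds from pairs of tents -/

theorem one_le_edist_vertexPoint {u v : V} (h : u ≠ v) :
    1 ≤ edist (X.vertexPoint u) (X.vertexPoint v) := by
  have := Marking.ofReal_le_edist (X := X) (vertexMarking_compatible u (r := 1 / 2) (by norm_num))
    (vertexMarking_compatible v (r := 1 / 2) (by norm_num)) ?_
    (vertexMarking_height_self u (by norm_num)) (vertexMarking_height_of_ne h _)
    (vertexMarking_height_of_ne h.symm _) (vertexMarking_height_self v (by norm_num))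
  · norm_num at this
    exact this
  norm_num
  refine ⟨fun e a ha b hb => ?_, fun t a ha b hb => ?_, fun p a ha b hb => ?_⟩
  · simp only [vertexMarking, edgeEnd] at ha hb
    split_ifs at ha hb <;> simp_all
    · rw [← ha, ← hb]; simp
    · rw [← ha, ← hb]; simp
  · obtain ⟨i, rfl, rfl⟩ := mem_cornerAt ha
    obtain ⟨j, rfl, rfl⟩ := mem_cornerAt hb
    exact isRoundPolygon_three.one_le_dist i j fun hij => h (by rw [hij])
  · obtain ⟨i, rfl, rfl⟩ := mem_cornerAt ha
    obtain ⟨j, rfl, rfl⟩ := mem_cornerAt hb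
    exact isRoundPolygon_five.one_le_dist i j fun hij => h (by rw [hij])

/-- Nonadjacent vertices share no edge and no triangle, so pentagons are the only cells in which the
tents could meet. -/
theorem ofReal_le_edist_vertexPoint_of_not_adj {u v : V} (h : u ≠ v) (huv : ¬ X.graph.Adj u v)
    {r : ℝ} (hr0 : 0 ≤ r) (hr : r ≤ 0.86)
    (hp : ∀ p i j, X.pent p i = u → X.pent p j = v →
      r + r ≤ dist (polygonCorner 5 i) (polygonCorner 5 j)) :
    ENNReal.ofReal (r + r) ≤ edist (X.vertexPoint u) (X.vertexPoint v) := by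
  refine Marking.ofReal_le_edist (vertexMarking_compatible u hr) (vertexMarking_compatible v hr) ?_
    (vertexMarking_height_self u hr0) (vertexMarking_height_of_ne h _)
    (vertexMarking_height_of_ne h.symm _) (vertexMarking_height_self v hr0)
  refine ⟨fun e a ha b hb => ?_, fun t a ha b hb => ?_, fun p a ha b hb => ?_⟩
  · have he := e.adj
    simp only [vertexMarking, edgeEnd] at ha hb
    split_ifs at ha hb with h1 h2 h3 h4 h5
    · exact absurd (h1.symm.trans h2) h
    · exact absurd (h1 ▸ h3 ▸ he) huv
    · cases hb
    · exact absurd (h4 ▸ h5 ▸ he.symm) huv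
    all_goals simp_all
  · obtain ⟨i, rfl, rfl⟩ := mem_cornerAt ha
    obtain ⟨j, rfl, rfl⟩ := mem_cornerAt hb
    refine absurd ((X.tri t).map_adj_iff.2 ?_) huv
    have : i ≠ j := fun hij => h (by rw [hij])
    clear * - this
    revert i j; decide
  · obtain ⟨i, hi, rfl⟩ := mem_cornerAt ha
    obtain ⟨j, hj, rfl⟩ := mem_cornerAt hb
    exact hp p i j hi hj

theorem le_edist_vertexPoint_of_not_adj {u v : V} (h : u ≠ v) (huv : ¬ X.graph.Adj u v) :
    ENNReal.ofReal 1.6 ≤ edist (X.vertexPoint u) (X.vertexPoint v) := by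
  -- Twice 0.8 stays below the diagonal of the pentagon, the golden ratio 1.618….
  have := ofReal_le_edist_vertexPoint_of_not_adj h huv (r := 0.8) (by norm_num) (by norm_num) ?_
  · norm_num at this ⊢
    exact this
  rintro p i j rfl rfl
  refine le_of_sq_le_sq ?_ dist_nonneg
  rw [dist_sq_polygonCorner_five_of_not_adj (fun hij => h (by rw [hij]))
    fun hij => huv ((X.pent p).map_adj_iff.2 hij)]
  linarith [sqrt_five_bounds.1]

theorem le_edist_vertexPoint_of_no_pentagon {u v : V} (h : u ≠ v) (huv : ¬ X.graph.Adj u v)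
    (hp : ∀ p i j, X.pent p i = u → X.pent p j ≠ v) :
    ENNReal.ofReal 1.72 ≤ edist (X.vertexPoint u) (X.vertexPoint v) := by
  -- With no common cell left, the largest admissible radius 0.86 can be used on both sides.
  have := ofReal_le_edist_vertexPoint_of_not_adj h huv (r := 0.86) (by norm_num) le_rfl
    fun p i j hi hj => absurd hj (hp p i j hi)
  norm_num at this ⊢
  exact this

theorem le_edist_centerPoint_vertexPoint {p : P} {v : V} (h : ∀ i, X.pent p i ≠ v) :
    ENNReal.ofReal 1.5 ≤ edist (X.centerPoint p) (X.vertexPoint v) := by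
  refine (ENNReal.ofReal_le_ofReal (show (1.5 : ℝ) ≤ 2 / 3 + 0.86 by norm_num)).trans
    (Marking.ofReal_le_edist (centerMarking_compatible p le_rfl)
      (vertexMarking_compatible v (r := 0.86) (by norm_num)) ?_ ?_ ?_ rfl
      (vertexMarking_height_self v (by norm_num)))
  · refine ⟨fun e a ha => ?_, fun t a ha => ?_, fun q a ha b hb => ?_⟩
    · cases ha
    · cases ha
    · simp only [centerMarking] at ha
      split_ifs at ha with hq
      · obtain ⟨i, hi, -⟩ := mem_cornerAt hb
        exact absurd (hq ▸ hi) (h i)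
      · cases ha
  · simp [Marking.height, centerMarking]
    norm_num
  · simp only [Marking.height, vertexMarking]
    rw [cornerAt, dif_neg (by simpa using h), tent_none]

theorem le_edist_centerPoint_centerPoint {p q : P} (h : p ≠ q) :
    ENNReal.ofReal 1.3 ≤ edist (X.centerPoint p) (X.centerPoint q) := by
  refine (ENNReal.ofReal_le_ofReal (show (1.3 : ℝ) ≤ 2 / 3 + 2 / 3 by norm_num)).trans
    (Marking.ofReal_le_edist (centerMarking_compatible p le_rfl)
      (centerMarking_compatible q le_rfl) ?_ ?_ ?_ ?_ ?_)
  · refine ⟨fun e a ha => ?_, fun t a ha => ?_, fun q a ha b hb => ?_⟩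
    · cases ha
    · cases ha
    · simp only [centerMarking] at ha hb
      split_ifs at ha hb with h1 h2
      · exact absurd (h1.symm.trans h2) h
      all_goals simp_all
  all_goals simp [Marking.height, centerMarking, h, h.symm]
  all_goals norm_num

/-- The hypotheses say that no cell has both edges as sides, so the two midpoint tents are never
present in the same cell. -/
theorem le_edist_edgePath {e f : X.graph.Dart} (he : e.edge ≠ f.edge)
    (ht : ∀ t i j, s(X.tri t i, X.tri t (i + 1)) = e.edge → s(X.tri t j, X.tri t (j + 1)) ≠ f.edge)
    (hp : ∀ p i j, s(X.pent p i, X.pent p (i + 1)) = e.edge →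
      s(X.pent p j, X.pent p (j + 1)) ≠ f.edge) :
    ENNReal.ofReal 0.86 ≤ edist (X.edgePath e (1 / 2)) (X.edgePath f (1 / 2)) := by
  have hm : (Set.projIcc (0 : ℝ) 1 zero_le_one (1 / 2) : ℝ) = 1 / 2 := by
    rw [Set.projIcc_of_mem zero_le_one (by norm_num)]
  refine (ENNReal.ofReal_le_ofReal (show (0.86 : ℝ) ≤ 0.43 + 0.43 by norm_num)).trans
    (Marking.ofReal_le_edist (midpointMarking_compatible e.edge (r := 0.43) le_rfl)
      (midpointMarking_compatible f.edge (r := 0.43) le_rfl) ?_ ?_ ?_ ?_ ?_)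
  · refine ⟨fun g a ha b hb => ?_, fun t a ha b hb => ?_, fun p a ha b hb => ?_⟩
    · simp only [midpointMarking] at ha hb
      split_ifs at ha hb with h1 h2
      · exact absurd (h1.symm.trans h2) he
      all_goals simp_all
    · obtain ⟨i, hi⟩ := exists_of_mem_midpointAt ha
      obtain ⟨j, hj⟩ := exists_of_mem_midpointAt hb
      exact absurd hj (ht t i j hi)
    · obtain ⟨i, hi⟩ := exists_of_mem_midpointAt ha
      obtain ⟨j, hj⟩ := exists_of_mem_midpointAt hb
      exact absurd hj (hp p i j hi)
  all_goals simp only [Marking.height, midpointMarking, hm]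
  all_goals simp [he, he.symm]
  all_goals norm_num

/-! ### Edges as geodesics, and upper bounds for distances -/

theorem edgePath_zero (e : X.graph.Dart) : X.edgePath e 0 = X.vertexPoint e.fst := by
  rw [edgePath, Set.projIcc_left]
  exact Quot.sound (.start e)

theorem edgePath_one (e : X.graph.Dart) : X.edgePath e 1 = X.vertexPoint e.snd := by
  rw [edgePath, Set.projIcc_right]
  refine (Quot.sound (.flip e 1)).trans ?_
  rw [unitInterval.symm_one]
  exact Quot.sound (.start e.symm)

theorem edist_edgePath_le (e : X.graph.Dart) (s t : ℝ) :
    edist (X.edgePath e s) (X.edgePath e t) ≤ ENNReal.ofReal |s - t| := by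
  refine (edist_le_of_cellStep (.edge e _ _)).trans (ENNReal.ofReal_le_ofReal ?_)
  rw [Subtype.dist_eq, Real.dist_eq]
  exact Set.abs_projIcc_sub_projIcc _

/-- The path is 1-Lipschitz of length 1 and its ends are at least 1 apart, so no part of it can be
shortened. -/
theorem isGeodesicPath_edgePath (e : X.graph.Dart) :
    IsGeodesicPath (X.edgePath e) 1 (X.vertexPoint e.fst) (X.vertexPoint e.snd) := by
  refine ⟨zero_le_one, edgePath_zero e, edgePath_one e, ?_⟩
  have key : ∀ s t : ℝ, 0 ≤ s → s ≤ t → t ≤ 1 →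
      ENNReal.ofReal |s - t| ≤ edist (X.edgePath e s) (X.edgePath e t) := by
    intro s t hs hst ht
    have h := (one_le_edist_vertexPoint (X := X) e.adj.ne)
    rw [← edgePath_zero, ← edgePath_one] at h
    have h' := h.trans (edist_triangle4 _ (X.edgePath e s) (X.edgePath e t) _)
    have h1 := edist_edgePath_le e 0 s
    have h2 := edist_edgePath_le e t 1
    rw [zero_sub, abs_neg, abs_of_nonneg hs] at h1
    rw [abs_sub_comm, abs_of_nonneg (by linarith)] at h2
    rw [abs_sub_comm, abs_of_nonneg (by linarith)]
    by_contra! hlt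
    obtain ⟨d, hd⟩ : ∃ d : NNReal, (d : ENNReal) = edist (X.edgePath e s) (X.edgePath e t) :=
      ⟨_, ENNReal.coe_toNNReal (hlt.trans ENNReal.ofReal_lt_top).ne⟩
    rw [← hd] at hlt h'
    have h3 := h'.trans (add_le_add (add_le_add h1 le_rfl) h2)
    rw [← ENNReal.ofReal_coe_nnreal, ← ENNReal.ofReal_add hs d.coe_nonneg,
      ← ENNReal.ofReal_add (by positivity) (by linarith), ← ENNReal.ofReal_one,
      ENNReal.ofReal_le_ofReal_iff (by positivity)] at h3
    rw [← ENNReal.ofReal_coe_nnreal, ENNReal.ofReal_lt_ofReal_iff_of_nonneg d.coe_nonneg] at hlt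
    linarith
  intro s hs t ht
  refine le_antisymm (edist_edgePath_le e s t) ?_
  rcases le_total s t with h | h
  · exact key s t hs.1 h ht.2
  · rw [abs_sub_comm, edist_comm]
    exact key t s ht.1 h hs.2

theorem edist_centerPoint_le (p : P) (i : Fin 5) :
    edist (X.centerPoint p) (X.vertexPoint (X.pent p i)) ≤ ENNReal.ofReal (√3 / 2) := by
  have hadj : X.graph.Adj (X.pent p i) (X.pent p (i + 1)) :=
    (X.pent p).map_adj_iff.2 (by clear * - i; revert i; decide)
  have h : X.vertexPoint (X.pent p i) =
      Quot.mk _ (.pent p ⟨polygonCorner 5 i, polygonCorner_mem_solidPolygon 5 i⟩) := by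
    refine ((Quot.sound (.pentSide p i ⟨(_, _), hadj⟩ 0 _ rfl rfl (by simp))).trans
      (Quot.sound (.start _))).symm
  rw [h]
  exact (edist_le_of_cellStep (.pent p _ _)).trans
    (ENNReal.ofReal_le_ofReal (dist_zero_polygonCorner_five_le i))

end TrianglePentagonComplex

/-! ### Links and full cycles in flag complexes -/

section flag

variable {α : Type*} {K : PreAbstractSimplicialComplex α} {σ : Finset α}

theorem PreAbstractSimplicialComplex.mem_faces_of_subset {s t : Finset α} (hs : s ∈ K.faces)
    (h : t ⊆ s) (ht : t.Nonempty) : t ∈ K.faces :=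
  (K.isRelLowerSet_faces hs).2 h ht

/-- Any two vertices of `s ∪ σ` are joined by an edge, so flagness makes it a simplex. Hence links
in a flag complex are full subcomplexes. -/
theorem IsFlagComplex.mem_simplicialLink (hK : IsFlagComplex K) (hσ : σ ∈ K.faces)
    {s : Finset α} (hs : s ∈ K.faces) (h : ∀ v ∈ s, {v} ∈ (simplicialLink K σ).faces) :
    s ∈ (simplicialLink K σ).faces := by
  classical
  have hne : s.Nonempty := (K.isRelLowerSet_faces hs).1
  have key : ∀ v ∈ s, ∀ w ∈ σ, ({v, w} : Finset α) ∈ K.faces := fun v hv w hw => by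
    obtain ⟨-, -, h⟩ := h v hv
    refine K.mem_faces_of_subset h ?_ (by simp)
    intro x hx
    rcases Finset.mem_insert.1 hx with rfl | hx
    · simp
    · rw [Finset.mem_singleton.1 hx]; simp [hw]
  have pair : ∀ τ ∈ K.faces, ∀ v ∈ τ, ∀ w ∈ τ, ({v, w} : Finset α) ∈ K.faces :=
    fun τ hτ v hv w hw => K.mem_faces_of_subset hτ (by
      intro x hx
      rcases Finset.mem_insert.1 hx with rfl | hx
      · exact hv
      · rwa [Finset.mem_singleton.1 hx]) (by simp)
  refine ⟨hs, Finset.disjoint_left.2 fun v hv hvσ => ?_, ?_⟩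
  · exact Finset.disjoint_left.1 (h v hv).2.1 (Finset.mem_singleton_self v) hvσ
  · have := hK (s ∪ σ) (hne.mono Finset.subset_union_left) fun v hv w hw => by
      rcases Finset.mem_union.1 hv with hv | hv <;> rcases Finset.mem_union.1 hw with hw | hw
      · convert pair s hs v hv w hw
      · convert key v hv w hw
      · rw [Finset.pair_comm]; convert key w hw v hv
      · convert pair σ hσ v hv w hw
    convert this

theorem IsFlagComplex.simplicialLink (hK : IsFlagComplex K) (hσ : σ ∈ K.faces) :
    IsFlagComplex (_root_.simplicialLink K σ) := by
  classical
  intro s hs h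
  refine hK.mem_simplicialLink hσ (hK s hs fun v hv w hw => (h v hv w hw).1) fun v hv => ?_
  have := h v hv v hv
  convert this
  simp

open Classical in
/-- Vertices which are not consecutive on a full cycle in a link are not joined by an edge. -/
theorem IsFlagComplex.pair_notMem_of_not_adj (hK : IsFlagComplex K) (hσ : σ ∈ K.faces) {k : ℕ}
    {c : Fin k → α} (hc : Function.Injective c)
    (hfull : ∀ s ∈ (_root_.simplicialLink K σ).faces, (s : Set α) ⊆ Set.range c →
      ∃ i j, (SimpleGraph.cycleGraph k).Adj i j ∧ s ⊆ {c i, c j})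
    (hmem : ∀ i, {c i} ∈ (_root_.simplicialLink K σ).faces) {i j : Fin k} (hij : i ≠ j)
    (hadj : ¬ (SimpleGraph.cycleGraph k).Adj i j) : ({c i, c j} : Finset α) ∉ K.faces := by
  intro h
  have hl := hK.mem_simplicialLink hσ h fun v hv => by
    rcases Finset.mem_insert.1 hv with rfl | hv
    · exact hmem i
    · rw [Finset.mem_singleton.1 hv]; exact hmem j
  obtain ⟨a, b, hab, hs⟩ := hfull _ hl (by
    intro x hx
    rcases Finset.mem_insert.1 (Finset.mem_coe.1 hx) with rfl | hx
    · exact ⟨i, rfl⟩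
    · exact ⟨j, (Finset.mem_singleton.1 hx).symm⟩)
  have hi : c i = c a ∨ c i = c b := by simpa using hs (Finset.mem_insert_self _ _)
  have hj : c j = c a ∨ c j = c b := by
    simpa using hs (Finset.mem_insert_of_mem (Finset.mem_singleton_self _))
  rcases hi with hi | hi <;> rcases hj with hj | hj <;> have hi := hc hi <;> have hj := hc hj <;>
    subst hi hj
  · exact hij rfl
  · exact hadj hab
  · exact hadj hab.symm
  · exact hij rfl

/-- By flagness the three vertices span a simplex, which is too large to lie in an edge of the
cycle. -/
theorem IsFlagComplex.not_hasFullCycle_three (hK : IsFlagComplex K) : ¬ HasFullCycle K 3 := by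
  classical
  rintro ⟨-, c, hc, hadj, hfull⟩
  have h : Finset.univ.image c ∈ K.faces := by
    refine hK _ (by simp) fun v hv w hw => ?_
    obtain ⟨i, -, rfl⟩ := Finset.mem_image.1 hv
    obtain ⟨j, -, rfl⟩ := Finset.mem_image.1 hw
    by_cases hij : i = j
    · subst hij
      refine K.mem_faces_of_subset (hadj i (i + 1) (by clear * - i; revert i; decide)) ?_ (by simp)
      simp
    · exact hadj i j (by clear * - hij; revert i j; decide)
  obtain ⟨i, j, -, hs⟩ := hfull _ h (by simp)
  have h1 := Finset.card_le_card hs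
  rw [Finset.card_image_of_injective _ hc, Finset.card_univ, Fintype.card_fin] at h1
  exact absurd (h1.trans Finset.card_le_two) (by norm_num)

open Classical in
/-- A flag complex without full `4`-cycles is locally `5`-large. -/
theorem IsFlagComplex.isLocallyLargeComplex_five (hK : IsFlagComplex K)
    (h4 : ∀ x y z w : α, x ≠ y → y ≠ z → z ≠ w → w ≠ x → x ≠ z → y ≠ w →
      ({x, y} : Finset α) ∈ K.faces → ({y, z} : Finset α) ∈ K.faces →
      ({z, w} : Finset α) ∈ K.faces → ({w, x} : Finset α) ∈ K.faces →
      ({x, z} : Finset α) ∉ K.faces → ({y, w} : Finset α) ∉ K.faces → False) :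
    IsLocallyLargeComplex 5 K := by
  intro σ hσ
  refine ⟨hK.simplicialLink hσ, fun j hj hfc => ?_⟩
  obtain rfl | rfl : j = 3 ∨ j = 4 := by have := hfc.1; omega
  · exact (hK.simplicialLink hσ).not_hasFullCycle_three hfc
  · obtain ⟨-, c, hc, hadj, hfull⟩ := hfc
    have hmem : ∀ i, {c i} ∈ (_root_.simplicialLink K σ).faces := fun i =>
      PreAbstractSimplicialComplex.mem_faces_of_subset
        (hadj i (i + 1) (by clear * - i; revert i; decide)) (by simp) (by simp)
    exact h4 (c 0) (c 1) (c 2) (c 3) (hc.ne (by decide)) (hc.ne (by decide)) (hc.ne (by decide))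
      (hc.ne (by decide)) (hc.ne (by decide)) (hc.ne (by decide))
      (hadj 0 1 (by decide)).1 (hadj 1 2 (by decide)).1 (hadj 2 3 (by decide)).1
      (hadj 3 0 (by decide)).1
      (hK.pair_notMem_of_not_adj hσ hc hfull hmem (by decide) (by decide))
      (hK.pair_notMem_of_not_adj hσ hc hfull hmem (by decide) (by decide))

open Classical in
theorem IsFlagComplex.exists_five_cycle (hK : IsFlagComplex K) {v : α} (hv : {v} ∈ K.faces)
    (h : HasFullCycle (_root_.simplicialLink K {v}) 5) :
    ∃ c : Fin 5 → α, Function.Injective c ∧ (∀ i, v ≠ c i) ∧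
      (∀ i, ({v, c i} : Finset α) ∈ K.faces) ∧
      (∀ i, ({c i, c (i + 1)} : Finset α) ∈ K.faces) ∧
      ∀ i, ({c i, c (i + 2)} : Finset α) ∉ K.faces := by
  obtain ⟨-, c, hc, hadj, hfull⟩ := h
  have hmem : ∀ i, {c i} ∈ (_root_.simplicialLink K {v}).faces := fun i =>
    PreAbstractSimplicialComplex.mem_faces_of_subset
      (hadj i (i + 1) (by clear * - i; revert i; decide)) (by simp) (by simp)
  refine ⟨c, hc, fun i hi => ?_, fun i => ?_, fun i => ?_, fun i => ?_⟩
  · exact Finset.disjoint_left.1 (hmem i).2.1 (Finset.mem_singleton_self _) (by simp [hi])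
  · refine K.mem_faces_of_subset (hmem i).2.2 ?_ (by simp)
    intro x
    simp only [Finset.mem_insert, Finset.mem_singleton, Finset.mem_union]
    exact Or.symm
  · exact (hadj i (i + 1) (by clear * - i; revert i; decide)).1
  · exact hK.pair_notMem_of_not_adj hv hc hfull hmem (by clear * - i; revert i; decide)
      (by clear * - i; revert i; decide)

end flag

namespace TrianglePentagonComplex

variable {V T P : Type*} {X : TrianglePentagonComplex V T P}

/-! ### The `1`-skeleton of the subdivision -/

variable (X) in
/-- The `1`-skeleton of `X.subdivision`. -/
def starGraph : SimpleGraph (V ⊕ P) where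
  Adj
    | .inl u, .inl w => X.graph.Adj u w
    | .inl u, .inr p => ∃ i, X.pent p i = u
    | .inr p, .inl u => ∃ i, X.pent p i = u
    | .inr _, .inr _ => False
  symm := ⟨by rintro (u | p) (w | q) h <;> first | exact h.symm | exact h⟩
  loopless := ⟨by rintro (u | p) h <;> first | exact h.ne rfl | exact h⟩

@[simp] theorem starGraph_adj_inl_inl {u w : V} :
    X.starGraph.Adj (.inl u) (.inl w) ↔ X.graph.Adj u w := Iff.rfl

theorem starGraph_adj_of_mem_faces {s : Finset (V ⊕ P)} (hs : s ∈ X.subdivision.faces)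
    {x y : V ⊕ P} (hx : x ∈ s) (hy : y ∈ s) (hxy : x ≠ y) : X.starGraph.Adj x y := by
  have hx := Finset.mem_coe.2 hx
  have hy := Finset.mem_coe.2 hy
  obtain ⟨-, ⟨v, h⟩ | ⟨u, w, hu, h⟩ | ⟨t, h⟩ | ⟨p, i, h⟩⟩ := hs
  · exact absurd ((h hx).trans (h hy).symm) hxy
  · rcases h hx with rfl | rfl <;> rcases h hy with rfl | rfl
    · exact absurd rfl hxy
    · exact hu
    · exact hu.symm
    · exact absurd rfl hxy
  · obtain ⟨i, rfl⟩ := h hx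
    obtain ⟨j, rfl⟩ := h hy
    have hij : i ≠ j := fun hij => hxy (by rw [hij])
    exact (X.tri t).map_adj_iff.2 (by clear * - hij; revert i j; decide)
  · have hi : X.graph.Adj (X.pent p i) (X.pent p (i + 1)) :=
      (X.pent p).map_adj_iff.2 (by clear * - i; revert i; decide)
    rcases h hx with rfl | rfl | rfl <;> rcases h hy with rfl | rfl | rfl <;>
      first
        | exact absurd rfl hxy
        | exact hi
        | exact hi.symm
        | exact ⟨_, rfl⟩

theorem pair_mem_faces_of_adj {_ : DecidableEq (V ⊕ P)} {x y : V ⊕ P} (h : X.starGraph.Adj x y) :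
    ({x, y} : Finset (V ⊕ P)) ∈ X.subdivision.faces := by
  refine ⟨by simp, ?_⟩
  rw [Finset.coe_pair]
  rcases x with u | p <;> rcases y with w | q
  · exact .inr (.inl ⟨u, w, h, le_rfl⟩)
  · obtain ⟨i, rfl⟩ := h
    refine .inr (.inr (.inr ⟨q, i, ?_⟩))
    rintro x (rfl | rfl) <;> simp
  · obtain ⟨i, rfl⟩ := h
    refine .inr (.inr (.inr ⟨p, i, ?_⟩))
    rintro x (rfl | rfl) <;> simp
  · exact h.elim

theorem adj_of_pair_mem_faces {_ : DecidableEq (V ⊕ P)} {x y : V ⊕ P} (hxy : x ≠ y)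
    (h : ({x, y} : Finset (V ⊕ P)) ∈ X.subdivision.faces) : X.starGraph.Adj x y :=
  starGraph_adj_of_mem_faces h (by simp) (by simp) hxy

theorem pent_no_triangle {p : P} {u v w : V} (hu : ∃ i, X.pent p i = u) (hv : ∃ i, X.pent p i = v)
    (hw : ∃ i, X.pent p i = w) (huv : X.graph.Adj u v) (hvw : X.graph.Adj v w)
    (huw : X.graph.Adj u w) : False := by
  obtain ⟨i, rfl⟩ := hu
  obtain ⟨j, rfl⟩ := hv
  obtain ⟨k, rfl⟩ := hw
  rw [(X.pent p).map_adj_iff] at huv hvw huw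
  revert i j k; decide

/-! ### Consequences of the CAT(0) inequality -/

variable (X) in
/-- A vertex of the subdivision, as a point of the space underlying `X`. -/
def starPoint : V ⊕ P → X.Realization :=
  Sum.elim X.vertexPoint X.centerPoint

theorem edist_vertexPoint_le {u v : V} (h : X.graph.Adj u v) :
    edist (X.vertexPoint u) (X.vertexPoint v) ≤ ENNReal.ofReal 1 := by
  have := edist_edgePath_le (X := X) ⟨(u, v), h⟩ 0 1
  rwa [edgePath_zero, edgePath_one, zero_sub, abs_neg, abs_one] at this

theorem sqrt_three_bounds : 1.7 < √3 ∧ √3 < 2 :=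
  ⟨Real.lt_sqrt_of_sq_lt (by norm_num), (Real.sqrt_lt' (by norm_num)).2 (by norm_num)⟩

theorem edist_starPoint_le {x y : V ⊕ P} (h : X.starGraph.Adj x y) :
    edist (X.starPoint x) (X.starPoint y) ≤ ENNReal.ofReal 1 := by
  have h3 : ENNReal.ofReal (√3 / 2) ≤ ENNReal.ofReal 1 :=
    ENNReal.ofReal_le_ofReal (by linarith [sqrt_three_bounds.2])
  rcases x with u | p <;> rcases y with w | q
  · exact edist_vertexPoint_le h
  · obtain ⟨i, rfl⟩ := h
    rw [edist_comm]
    exact (edist_centerPoint_le q i).trans h3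
  · obtain ⟨i, rfl⟩ := h
    exact (edist_centerPoint_le p i).trans h3
  · exact h.elim

theorem le_edist_starPoint_inl {u : V} {y : V ⊕ P} (h : .inl u ≠ y)
    (hadj : ¬ X.starGraph.Adj (.inl u) y) :
    ENNReal.ofReal 1.5 ≤ edist (X.starPoint (.inl u)) (X.starPoint y) := by
  rcases y with w | q
  · exact (ENNReal.ofReal_le_ofReal (by norm_num)).trans
      (le_edist_vertexPoint_of_not_adj (fun e => h (by rw [e])) hadj)
  · rw [edist_comm]
    exact le_edist_centerPoint_vertexPoint fun i hi => hadj ⟨i, hi⟩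

end TrianglePentagonComplex

section PseudoMetricSpace

variable {M : Type*} [PseudoMetricSpace M] {x y : M} {r : ℝ}

theorem dist_le_of_edist_le (hr : 0 ≤ r) (h : edist x y ≤ ENNReal.ofReal r) : dist x y ≤ r := by
  rwa [edist_dist, ENNReal.ofReal_le_ofReal_iff hr] at h

theorem le_dist_of_le_edist (h : ENNReal.ofReal r ≤ edist x y) : r ≤ dist x y := by
  rwa [edist_dist, ENNReal.ofReal_le_ofReal_iff dist_nonneg] at h

theorem dist_sq_le_of_edist_le (hr : 0 ≤ r) (h : edist x y ≤ ENNReal.ofReal r) :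
    dist x y ^ 2 ≤ r ^ 2 := by
  have := dist_le_of_edist_le hr h
  gcongr

theorem le_dist_sq_of_le_edist (hr : 0 ≤ r) (h : ENNReal.ofReal r ≤ edist x y) :
    r ^ 2 ≤ dist x y ^ 2 := by
  have := le_dist_of_le_edist h
  gcongr

end PseudoMetricSpace

namespace TrianglePentagonComplex

variable {V T P : Type*} {X : TrianglePentagonComplex V T P}

/-- The distance from a common neighbour to the midpoint of an edge. -/
theorem dist_edgePath_half_sq_le (hX : IsCATZero X.Realization) (e : X.graph.Dart) {w : V}
    (h1 : X.graph.Adj e.fst w) (h2 : X.graph.Adj e.snd w) :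
    letI := hX.toPseudoMetricSpace
    dist (X.edgePath e (1 / 2)) (X.vertexPoint w) ^ 2 ≤ 3 / 4 := by
  let := hX.toPseudoMetricSpace
  have h := IsCATZero.dist_midpoint_sq_le hX (isGeodesicPath_edgePath e) (X.vertexPoint w)
  have h3 := dist_sq_le_of_edist_le zero_le_one (edist_vertexPoint_le h1)
  have h4 := dist_sq_le_of_edist_le zero_le_one (edist_vertexPoint_le h2)
  linarith

/-- Both `a` and `c` are within √3/2 of the midpoint of `ue`, as in a rhombus of two equilateral
triangles. -/
theorem edist_le_sqrt_three_of_edge (hX : IsCATZero X.Realization) {u e a c : V}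
    (hue : X.graph.Adj u e) (hua : X.graph.Adj u a) (hea : X.graph.Adj e a)
    (huc : X.graph.Adj u c) (hec : X.graph.Adj e c) :
    edist (X.vertexPoint a) (X.vertexPoint c) ≤ ENNReal.ofReal √3 := by
  let := hX.toPseudoMetricSpace
  have h1 := dist_edgePath_half_sq_le hX ⟨(u, e), hue⟩ hua hea
  have h2 := dist_edgePath_half_sq_le hX ⟨(u, e), hue⟩ huc hec
  have h3 := dist_triangle_left (X.vertexPoint a) (X.vertexPoint c)
    (X.edgePath ⟨(u, e), hue⟩ (1 / 2))
  have hs : (√3 / 2) ^ 2 = 3 / 4 := by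
    rw [div_pow, Real.sq_sqrt (by norm_num)]; norm_num
  have h4 := le_of_sq_le_sq (h1.trans hs.ge) (by positivity)
  have h5 := le_of_sq_le_sq (h2.trans hs.ge) (by positivity)
  rw [edist_dist]
  exact ENNReal.ofReal_le_ofReal (by linarith)

theorem edist_le_sqrt_three_of_pentagon {q : P} {a c : V} (ha : ∃ i, X.pent q i = a)
    (hc : ∃ i, X.pent q i = c) :
    edist (X.vertexPoint a) (X.vertexPoint c) ≤ ENNReal.ofReal √3 := by
  obtain ⟨i, rfl⟩ := ha
  obtain ⟨j, rfl⟩ := hc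
  refine (edist_triangle_left _ _ (X.centerPoint q)).trans
    ((add_le_add (edist_centerPoint_le q i) (edist_centerPoint_le q j)).trans ?_)
  rw [← ENNReal.ofReal_add (by positivity) (by positivity), add_halves]

/-- Every `3`-cycle of the `1`-skeleton bounds a triangle. -/
theorem exists_tri_of_adj (hX : IsCATZero X.Realization) {u v w : V} (huv : X.graph.Adj u v)
    (hvw : X.graph.Adj v w) (huw : X.graph.Adj u w) :
    ∃ t, (∃ i, X.tri t i = u) ∧ (∃ i, X.tri t i = v) ∧ ∃ i, X.tri t i = w := by
  by_contra hno
  let := hX.toPseudoMetricSpace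
  -- Without a triangle on `u, v, w`, no cell has both `uv` and `uw` as sides: a pentagon would
  -- acquire three mutually adjacent corners. So the midpoints of these edges are at least 0.86
  -- apart.
  have hlow := le_dist_sq_of_le_edist (by norm_num) <|
    le_edist_edgePath (X := X) (e := ⟨(u, v), huv⟩) (f := ⟨(u, w), huw⟩) (by
      intro h
      rcases Sym2.eq_iff.1 h with h | h
      · exact hvw.ne h.2
      · exact huw.ne h.1) (by
      intro t i j hi hj
      rcases Sym2.eq_iff.1 hi with hi | hi <;> rcases Sym2.eq_iff.1 hj with hj | hj <;>
        exact hno ⟨t, ⟨_, by first | exact hi.1 | exact hi.2⟩,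
          ⟨_, by first | exact hi.1 | exact hi.2⟩, ⟨_, by first | exact hj.1 | exact hj.2⟩⟩) (by
      intro t i j hi hj
      rcases Sym2.eq_iff.1 hi with hi | hi <;> rcases Sym2.eq_iff.1 hj with hj | hj <;>
        exact pent_no_triangle ⟨_, by first | exact hi.1 | exact hi.2⟩
          ⟨_, by first | exact hi.1 | exact hi.2⟩ ⟨_, by first | exact hj.1 | exact hj.2⟩
          huv hvw huw)
  have h1 := dist_edgePath_half_sq_le hX ⟨(u, v), huv⟩ huw hvw
  -- The CAT(0) bound for the squared distance of the midpoints is (1/2)(1/4) + (1/2)(3/4) - 1/4 =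
  -- 1/4, below 0.86².
  have h2 := IsCATZero.dist_midpoint_sq_le hX (isGeodesicPath_edgePath ⟨(u, w), huw⟩)
    (X.edgePath ⟨(u, v), huv⟩ (1 / 2))
  have h3 := dist_sq_le_of_edist_le (abs_nonneg _)
    (edist_edgePath_le (X := X) ⟨(u, v), huv⟩ 0 (1 / 2))
  rw [edgePath_zero] at h3
  rw [dist_comm] at h1 hlow
  norm_num at h1 h2 h3 hlow
  linarith

/-- The opposite edges `ab` and `cd` lie in no common cell, so their midpoints are at least 0.86
apart. Applying the midpoint inequality twice bounds the squared distance by 3/4 - 1/4 = 1/2. -/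
theorem not_four_clique (hX : IsCATZero X.Realization) {a b c d : V} (hab : X.graph.Adj a b)
    (hac : X.graph.Adj a c) (had : X.graph.Adj a d) (hbc : X.graph.Adj b c)
    (hbd : X.graph.Adj b d) (hcd : X.graph.Adj c d) : False := by
  let := hX.toPseudoMetricSpace
  have hlow := le_dist_sq_of_le_edist (by norm_num) <|
    le_edist_edgePath (X := X) (e := ⟨(a, b), hab⟩) (f := ⟨(c, d), hcd⟩) (by
      intro h
      rcases Sym2.eq_iff.1 h with h | h
      · exact hac.ne h.1
      · exact had.ne h.1) (by
      intro t i j hi hj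
      have h1 : i ≠ j := by
        rintro rfl
        rcases Sym2.eq_iff.1 (hi.symm.trans hj) with h | h
        · exact hac.ne h.1
        · exact had.ne h.1
      have h2 : i = j + 1 ∨ i + 1 = j := by clear * - h1; revert i j; decide
      have h3 : X.tri t i = X.tri t (j + 1) ∨ X.tri t (i + 1) = X.tri t j :=
        h2.imp (congrArg _) (congrArg _)
      rcases Sym2.eq_iff.1 hi with hi | hi <;> rcases Sym2.eq_iff.1 hj with hj | hj <;>
        rw [hi.1, hi.2, hj.1, hj.2] at h3 <;> rcases h3 with h3 | h3 <;>
        first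
          | exact hac.ne h3
          | exact had.ne h3
          | exact hbc.ne h3
          | exact hbd.ne h3) (by
      intro t i j hi hj
      rcases Sym2.eq_iff.1 hi with hi | hi <;> rcases Sym2.eq_iff.1 hj with hj | hj <;>
        exact pent_no_triangle ⟨_, by first | exact hi.1 | exact hi.2⟩
          ⟨_, by first | exact hi.1 | exact hi.2⟩ ⟨_, by first | exact hj.1 | exact hj.2⟩
          hab hbc hac)
  have h1 := dist_edgePath_half_sq_le hX ⟨(a, b), hab⟩ hac hbc
  have h2 := dist_edgePath_half_sq_le hX ⟨(a, b), hab⟩ had hbd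
  have h3 := IsCATZero.dist_midpoint_sq_le hX (isGeodesicPath_edgePath ⟨(c, d), hcd⟩)
    (X.edgePath ⟨(a, b), hab⟩ (1 / 2))
  rw [dist_comm] at h1 h2 hlow
  norm_num at h1 h2 h3 hlow
  linarith

/-- The `1`-skeleton of the subdivision has no full `4`-cycles. -/
theorem starGraph_no_four_cycle (hX : IsCATZero X.Realization) {x y z w : V ⊕ P}
    (hxy : X.starGraph.Adj x y) (hyz : X.starGraph.Adj y z) (hzw : X.starGraph.Adj z w)
    (hwx : X.starGraph.Adj w x) (hxz : x ≠ z) (hyw : y ≠ w) (hxz' : ¬ X.starGraph.Adj x z)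
    (hyw' : ¬ X.starGraph.Adj y w) : False := by
  let := hX.toPseudoMetricSpace
  have h := IsCATZero.diagonals_sq_le hX (X.starPoint x) (X.starPoint y) (X.starPoint z)
    (X.starPoint w)
  have h1 := dist_sq_le_of_edist_le zero_le_one (edist_starPoint_le hxy)
  have h2 := dist_sq_le_of_edist_le zero_le_one (edist_starPoint_le hyz)
  have h3 := dist_sq_le_of_edist_le zero_le_one (edist_starPoint_le hzw)
  have h4 := dist_sq_le_of_edist_le zero_le_one (edist_starPoint_le hwx)
  -- The four sides contribute at most 4. Centres are never adjacent, so if one diagonal joins two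
  -- centres, the other joins two vertices of X and 1.3² + 1.6² = 4.25 > 4. In all other cases each
  -- diagonal is at least 1.5, and 2 · 1.5² = 4.5.
  have inl : ∀ {u : V} {y : V ⊕ P}, .inl u ≠ y → ¬ X.starGraph.Adj (.inl u) y →
      1.5 ^ 2 ≤ dist (X.starPoint (.inl u)) (X.starPoint y) ^ 2 := fun h h' =>
    le_dist_sq_of_le_edist (by norm_num) (le_edist_starPoint_inl h h')
  have inl_inl : ∀ {u w : V}, (.inl u : V ⊕ P) ≠ .inl w → ¬ X.graph.Adj u w →
      1.6 ^ 2 ≤ dist (X.starPoint (.inl u)) (X.starPoint (.inl w)) ^ 2 := fun h h' =>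
    le_dist_sq_of_le_edist (by norm_num)
      (le_edist_vertexPoint_of_not_adj (fun e => h (by rw [e])) h')
  have inr_inr : ∀ {p q : P}, (.inr p : V ⊕ P) ≠ .inr q →
      1.3 ^ 2 ≤ dist (X.starPoint (.inr p)) (X.starPoint (.inr q)) ^ 2 := fun h =>
    le_dist_sq_of_le_edist (by norm_num)
      (le_edist_centerPoint_centerPoint (fun e => h (by rw [e])))
  rcases x with x | p
  · have h5 := inl hxz hxz'
    rcases y with y | q
    · have h6 := inl hyw hyw'
      linarith
    · rcases z with z | r
      · have h5 := inl_inl hxz hxz'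
        rcases w with w | s
        · have h6 := inl hyw.symm (fun h => hyw' h.symm)
          rw [dist_comm] at h6
          linarith
        · have h6 := inr_inr hyw
          linarith
      · exact hyz.elim
  · rcases y with y | q
    · rcases w with w | s
      · have h6 := inl_inl hyw hyw'
        rcases z with z | r
        · have h5 := inl hxz.symm (fun h => hxz' h.symm)
          rw [dist_comm] at h5
          linarith
        · have h5 := inr_inr hxz
          linarith
      · exact hwx.elim
    · exact hxy.elim

/-! ### Excluding 5-wheels around vertices of X -/

/-- In the quadrilateral formed by `a`, the centre, `b` and `c`, the squared diagonals sum to at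
least 1.6² + 1.5² = 4.81, whereas `IsCATZero.diagonals_sq_le'` allows only 3/4 + 1 + 3/2 + 3/2 =
4.75. -/
theorem false_of_pentagon_and_vertex (hX : IsCATZero X.Realization) {p : P} {a b c : V}
    (ha : ∃ i, X.pent p i = a) (hb : ∃ i, X.pent p i = b) (hab : a ≠ b)
    (hab' : ¬ X.graph.Adj a b) (hc : ¬ ∃ i, X.pent p i = c) (hbc : X.graph.Adj b c)
    (hac : edist (X.vertexPoint a) (X.vertexPoint c) ≤ ENNReal.ofReal √3) : False := by
  let := hX.toPseudoMetricSpace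
  have h := IsCATZero.diagonals_sq_le' hX (X.vertexPoint a) (X.centerPoint p) (X.vertexPoint b)
    (X.vertexPoint c)
  have h1 := dist_sq_le_of_edist_le (Real.sqrt_nonneg _) hac
  have h2 := dist_sq_le_of_edist_le zero_le_one (edist_vertexPoint_le hbc)
  have h3 := le_dist_sq_of_le_edist (by norm_num) (le_edist_vertexPoint_of_not_adj hab hab')
  have h4 := le_dist_sq_of_le_edist (by norm_num)
    (le_edist_centerPoint_vertexPoint (p := p) (v := c) fun i hi => hc ⟨i, hi⟩)
  obtain ⟨i, rfl⟩ := ha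
  obtain ⟨j, rfl⟩ := hb
  have h5 := dist_sq_le_of_edist_le (by positivity) (edist_centerPoint_le (X := X) p i)
  have h6 := dist_sq_le_of_edist_le (by positivity) (edist_centerPoint_le (X := X) p j)
  rw [div_pow, Real.sq_sqrt (by norm_num)] at h5 h6
  rw [Real.sq_sqrt (by norm_num)] at h1
  rw [dist_comm (X.vertexPoint (X.pent p i)) (X.centerPoint p)] at h
  linarith

/-- The link of a vertex of `X` in the subdivision has no full `5`-cycles. -/
theorem starGraph_no_five_wheel (hX : IsCATZero X.Realization) {u : V} {c : Fin 5 → V ⊕ P}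
    (hu : ∀ i, X.starGraph.Adj (.inl u) (c i)) (hc : ∀ i, X.starGraph.Adj (c i) (c (i + 1)))
    (hne : ∀ i, c i ≠ c (i + 2)) (hn : ∀ i, ¬ X.starGraph.Adj (c i) (c (i + 2))) : False := by
  by_cases hp : ∃ i p, c i = .inr p
  · obtain ⟨i, p, hi⟩ := hp
    obtain ⟨x₀, h0⟩ : ∃ x, x = c i := ⟨_, rfl⟩
    obtain ⟨x₁, h1⟩ : ∃ x, x = c (i + 1) := ⟨_, rfl⟩
    obtain ⟨x₂, h2⟩ : ∃ x, x = c (i + 2) := ⟨_, rfl⟩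
    obtain ⟨x₃, h3⟩ : ∃ x, x = c (i + 3) := ⟨_, rfl⟩
    obtain ⟨x₄, h4⟩ : ∃ x, x = c (i + 4) := ⟨_, rfl⟩
    have e1 : i + 1 + 1 = i + 2 := by clear * - i; revert i; decide
    have e2 : i + 2 + 1 = i + 3 := by clear * - i; revert i; decide
    have e3 : i + 3 + 1 = i + 4 := by clear * - i; revert i; decide
    have e4 : i + 4 + 1 = i := by clear * - i; revert i; decide
    have e5 : i + 3 + 2 = i := by clear * - i; revert i; decide
    have e6 : i + 4 + 2 = i + 1 := by clear * - i; revert i; decide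
    have a01 := hc i
    have a12 := hc (i + 1)
    have a23 := hc (i + 2)
    have a34 := hc (i + 3)
    have a40 := hc (i + 4)
    have n02 := hn i
    have n30 := hn (i + 3)
    have n41 := hn (i + 4)
    have ne41 := hne (i + 4)
    have u2 := hu (i + 2)
    have u3 := hu (i + 3)
    have u4 := hu (i + 4)
    rw [e1] at a12
    rw [e2] at a23
    rw [e3] at a34
    rw [e4] at a40
    rw [e5] at n30
    rw [e6] at n41 ne41
    rw [hi] at a01 a40 n02 n30
    rw [← h1, ← h2, ← h3, ← h4] at *
    rcases x₁ with b | _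
    swap
    · exact a01.elim
    rcases x₄ with a | _
    swap
    · exact a40.elim
    have hab : a ≠ b := fun h => ne41 (by rw [h])
    -- Now `a` and `b` are nonadjacent corners of `p`. Of the two remaining rim vertices at least
    -- one is a vertex of X; it is off `p` and adjacent to one of `a`, `b`. It is within √3 of the
    -- other one, through the edge from `u` to the last rim vertex or through a pentagon centred
    -- there.
    rcases x₂ with d | q
    · refine false_of_pentagon_and_vertex hX a40 a01 hab n41 n02 a12 ?_
      rcases x₃ with e | q
      · exact edist_le_sqrt_three_of_edge hX u3 u4 a34 u2 a23.symm
      · exact edist_le_sqrt_three_of_pentagon a34 a23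
    · rcases x₃ with e | q'
      · exact false_of_pentagon_and_vertex hX a01 a40 hab.symm (fun h => n41 h.symm) n30 a34.symm
          (edist_le_sqrt_three_of_pentagon a12 a23)
      · exact a23.elim
  · have hV : ∀ i, ∃ v, c i = .inl v := fun i => by
      rcases h : c i with v | p
      · exact ⟨v, rfl⟩
      · exact absurd ⟨i, p, h⟩ hp
    choose f hf using hV
    simp only [hf, starGraph_adj_inl_inl] at hu hc hn
    have hne' : ∀ i, f i ≠ f (i + 2) := fun i h => hne i (by rw [hf, hf, h])
    have key : ∀ i, ENNReal.ofReal 1.72 ≤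
        edist (X.vertexPoint (f i)) (X.vertexPoint (f (i + 2))) := by
      intro i
      refine le_edist_vertexPoint_of_no_pentagon (hne' i) (hn i) fun p j k hj hk => ?_
      have e1 : i + 1 + 1 = i + 2 := by clear * - i; revert i; decide
      have hi := hc i
      have hi' := hc (i + 1)
      rw [e1] at hi'
      -- If a pentagon contained `f i` and `f (i + 2)`, every common neighbour of these would lie on
      -- it, as otherwise it would complete a full 4-cycle through the centre. Applied to `u` and `f
      -- (i + 1)`, this puts a 3-cycle on the pentagon.
      have four : ∀ v, X.graph.Adj v (f i) → X.graph.Adj v (f (i + 2)) → ∃ l, X.pent p l = v := by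
        intro v h1 h2
        by_contra hv
        exact starGraph_no_four_cycle hX (x := .inr p) (y := .inl (f i)) (z := .inl v)
          (w := .inl (f (i + 2))) ⟨j, hj⟩ h1.symm h2 ⟨k, hk⟩ (by simp)
          (fun h => hne' i (Sum.inl_injective h)) hv (hn i)
      exact pent_no_triangle (four u (hu i) (hu _)) ⟨j, hj⟩ (four _ hi.symm hi') (hu i) hi (hu _)
    let := hX.toPseudoMetricSpace
    -- The squared diagonals give at least 2 · 1.72² ≈ 5.92 against 1 + 1 + 2 + 3/2 = 5.5, where `f
    -- 0` and `f 3` are within √3 through the edge from `u` to `f 4`. The sum of squared sides would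
    -- allow 6, which is not enough.
    have h := IsCATZero.diagonals_sq_le' hX (X.vertexPoint (f 0)) (X.vertexPoint (f 1))
      (X.vertexPoint (f 2)) (X.vertexPoint (f 3))
    have h1 := le_dist_sq_of_le_edist (by norm_num) (key 0)
    have h2 := le_dist_sq_of_le_edist (by norm_num) (key 1)
    have h3 := dist_sq_le_of_edist_le zero_le_one (edist_vertexPoint_le (hc 0))
    have h4 := dist_sq_le_of_edist_le zero_le_one (edist_vertexPoint_le (hc 1))
    have h5 := dist_sq_le_of_edist_le zero_le_one (edist_vertexPoint_le (hc 2))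
    have h6 := dist_sq_le_of_edist_le (Real.sqrt_nonneg _)
      (edist_le_sqrt_three_of_edge hX (hu 4) (hu 0) (hc 4) (hu 3) (hc 3).symm)
    rw [Real.sq_sqrt (by norm_num)] at h6
    simp only [zero_add, show (1 + 1 : Fin 5) = 2 from rfl, show (2 + 1 : Fin 5) = 3 from rfl,
      show (1 + 2 : Fin 5) = 3 from rfl] at h1 h2 h3 h4 h5
    norm_num at h1 h2
    linarith

/-! ### Flagness of the subdivision and the main theorem -/

theorem isFlagComplex_subdivision (hX : IsCATZero X.Realization) :
    IsFlagComplex X.subdivision.toPreAbstractSimplicialComplex := by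
  intro s hs h
  have hadj : ∀ x ∈ s, ∀ y ∈ s, x ≠ y → X.starGraph.Adj x y := fun x hx y hy hxy =>
    adj_of_pair_mem_faces hxy (h x hx y hy)
  refine ⟨hs, ?_⟩
  by_cases hp : ∃ p, .inr p ∈ s
  · obtain ⟨p, hp⟩ := hp
    refine .inr (.inr (.inr ⟨p, ?_⟩))
    have hmem : ∀ x ∈ s, x = .inr p ∨ ∃ i, x = .inl (X.pent p i) := by
      intro x hx
      by_cases hxp : x = .inr p
      · exact .inl hxp
      · have := hadj x hx _ hp hxp
        rcases x with v | q
        · obtain ⟨i, rfl⟩ := this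
          exact .inr ⟨i, rfl⟩
        · exact this.elim
    have hpair : ∀ i j, .inl (X.pent p i) ∈ s → .inl (X.pent p j) ∈ s → i ≠ j →
        (SimpleGraph.cycleGraph 5).Adj i j := fun i j hi hj hij =>
      (X.pent p).map_adj_iff.1
        (hadj _ hi _ hj fun e => hij ((X.pent p).injective (Sum.inl_injective e)))
    have hI : ∃ i, ∀ j, .inl (X.pent p j) ∈ s → j = i ∨ j = i + 1 := by
      -- A clique of the 5-cycle is empty, one vertex, or two consecutive vertices. In the empty
      -- case the clique is the centre alone and any `i` serves.
      have key : ∀ I : Fin 5 → Prop, (∀ i j, I i → I j → i ≠ j →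
          (SimpleGraph.cycleGraph 5).Adj i j) → ∃ i, ∀ j, I j → j = i ∨ j = i + 1 := by
        intro I hI
        by_cases h1 : ∃ i, I i ∧ I (i + 1)
        · obtain ⟨i, hi, hi'⟩ := h1
          refine ⟨i, fun j hj => ?_⟩
          have h2 := hI i j hi hj
          have h3 := hI (i + 1) j hi' hj
          clear * - h2 h3
          revert i j; decide
        · by_cases h2 : ∃ i, I i
          · obtain ⟨i, hi⟩ := h2
            refine ⟨i, fun j hj => ?_⟩
            have h3 := hI i j hi hj
            have h4 : j ≠ i + 1 := fun e => h1 ⟨i, hi, e ▸ hj⟩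
            have h5 : i ≠ j + 1 := fun e => h1 ⟨j, hj, e ▸ hi⟩
            clear * - h3 h4 h5
            revert i j; decide
          · exact ⟨0, fun j hj => absurd ⟨j, hj⟩ h2⟩
      exact key _ hpair
    obtain ⟨i, hi⟩ := hI
    refine ⟨i, fun x hx => ?_⟩
    rcases hmem x hx with rfl | ⟨j, rfl⟩
    · simp
    · rcases hi j hx with rfl | rfl <;> simp
  · have hV : ∀ x ∈ s, ∃ v, x = .inl v := fun x hx => by
      rcases x with v | p
      · exact ⟨v, rfl⟩
      · exact absurd ⟨p, hx⟩ hp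
    obtain ⟨x, hx⟩ := hs
    obtain ⟨u, rfl⟩ := hV x hx
    by_cases h1 : ∃ v, .inl v ∈ s ∧ u ≠ v
    · obtain ⟨v, hv, huv⟩ := h1
      have auv : X.graph.Adj u v := hadj _ hx _ hv (by simpa using huv)
      by_cases h2 : ∃ w, .inl w ∈ s ∧ u ≠ w ∧ v ≠ w
      · obtain ⟨w, hw, huw, hvw⟩ := h2
        have auw : X.graph.Adj u w := hadj _ hx _ hw (by simpa using huw)
        have avw : X.graph.Adj v w := hadj _ hv _ hw (by simpa using hvw)
        obtain ⟨t, ⟨i, rfl⟩, ⟨j, rfl⟩, ⟨k, rfl⟩⟩ := exists_tri_of_adj hX auv avw auw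
        refine .inr (.inr (.inl ⟨t, fun y hy => ?_⟩))
        obtain ⟨z, rfl⟩ := hV y hy
        by_contra hz
        have hz : ∀ l, X.tri t l ≠ z := fun l hl => hz ⟨l, by rw [← hl]⟩
        have az : ∀ l, .inl (X.tri t l) ∈ s → X.graph.Adj (X.tri t l) z := fun l hl =>
          hadj _ hl _ hy (by simpa using hz l)
        exact not_four_clique hX auv auw (az i hx) avw (az j hv) (az k hw)
      · refine .inr (.inl ⟨u, v, auv, fun y hy => ?_⟩)
        obtain ⟨z, rfl⟩ := hV y hy
        by_contra hz
        simp only [Set.mem_insert_iff, Set.mem_singleton_iff, Sum.inl.injEq, not_or] at hz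
        exact h2 ⟨z, hy, Ne.symm hz.1, Ne.symm hz.2⟩
    · refine .inl ⟨.inl u, fun y hy => ?_⟩
      obtain ⟨z, rfl⟩ := hV y hy
      by_contra hz
      exact h1 ⟨z, hy, fun e => hz (by rw [e]; rfl)⟩

end TrianglePentagonComplex

theorem lemma3p2 {V T P : Type*} (X : TrianglePentagonComplex V T P)
    (hX : IsCATZero X.Realization) :
    (∀ v : V ⊕ P,
      ¬ IsExactlyLargeVertex X.subdivision.toPreAbstractSimplicialComplex 3 v ∧
      ¬ IsExactlyLargeVertex X.subdivision.toPreAbstractSimplicialComplex 4 v) ∧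
    IsFlagComplex X.subdivision.toPreAbstractSimplicialComplex ∧
    IsLocallyLargeComplex 5 X.subdivision.toPreAbstractSimplicialComplex ∧
    ∀ v : V ⊕ P,
      IsExactlyLargeVertex X.subdivision.toPreAbstractSimplicialComplex 5 v →
      ∃ p : P, v = Sum.inr p := by
  have hflag := TrianglePentagonComplex.isFlagComplex_subdivision hX
  have hlarge : IsLocallyLargeComplex 5 X.subdivision.toPreAbstractSimplicialComplex := by
    refine hflag.isLocallyLargeComplex_five fun x y z w hxy hyz hzw hwx hxz hyw a1 a2 a3 a4 n1 n2 =>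
      ?_
    exact TrianglePentagonComplex.starGraph_no_four_cycle hX
      (TrianglePentagonComplex.adj_of_pair_mem_faces hxy a1)
      (TrianglePentagonComplex.adj_of_pair_mem_faces hyz a2)
      (TrianglePentagonComplex.adj_of_pair_mem_faces hzw a3)
      (TrianglePentagonComplex.adj_of_pair_mem_faces hwx a4) hxz hyw
      (fun h => n1 (TrianglePentagonComplex.pair_mem_faces_of_adj h))
      (fun h => n2 (TrianglePentagonComplex.pair_mem_faces_of_adj h))
  have hv : ∀ v, {v} ∈ X.subdivision.faces := X.subdivision.singleton_mem
  refine ⟨fun v => ⟨fun h => ?_, fun h => ?_⟩, hflag, hlarge, fun v h => ?_⟩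
  · exact (hlarge {v} (hv v)).2 3 (by norm_num) h.1
  · exact (hlarge {v} (hv v)).2 4 (by norm_num) h.1
  · rcases v with u | p
    · obtain ⟨c, hc, hu, hu', hadj, hn⟩ := hflag.exists_five_cycle (hv _) h.1
      have h1 : ∀ i : Fin 5, i ≠ i + 1 := by decide
      have h2 : ∀ i : Fin 5, i ≠ i + 2 := by decide
      exact (TrianglePentagonComplex.starGraph_no_five_wheel hX
        (fun i => TrianglePentagonComplex.adj_of_pair_mem_faces (hu i) (hu' i))
        (fun i => TrianglePentagonComplex.adj_of_pair_mem_faces (hc.ne (h1 i)) (hadj i))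
        (fun i => hc.ne (h2 i))
        (fun i h => hn i (TrianglePentagonComplex.pair_mem_faces_of_adj h))).elim
    · exact ⟨p, rfl⟩
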